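/- For $c,\kappa\in\mathbb R$ consider the travelling wave equation $$ icu'+u''+u(1-|u|^2)+\kappa u(1-|u|^2)''=0 \quad\text{in }\mathbb R, \qquad (\mathrm{TW}(c,\kappa))$$ and the energy space $\mathcal X(\mathbb R)=\{u\in H^1_{\rm loc}(\mathbb R;\mathbb C):\ 1-|u|^2\in L^2(\mathbb R),\ u'\in L^2(\mathbb R)\}$, whose elements are identified with their continuous representatives. With $\langle z,w\rangle=\mathrm{Re}\,z\,\mathrm{Re}\,w+\mathrm{Im}\,z\,\mathrm{Im}\,w$, a function $u\in\mathcal X(\mathbb R)$ is a (weak) solution of $(\mathrm{TW}(c,\kappa))$ if $$\int_{\mathbb R}\langle icu'+u(1-|u|^2),\phi\rangle-\langle u',\phi'\rangle+2\kappa\langle u,u'\rangle\langle u,\phi\rangle'=0\quad\text{for all }\phi\in C_c^\infty(\mathbb R;\mathbb C);$$ it is trivial if it is a constant of modulus one. Put $$\Gamma(u)=\{x\in\mathbb R:\ |u(x)|^2=1/(2\kappa)\},\qquad \mathcal N(u)=\{x\in\mathbb R:\ u\text{ is not differentiable at }x\}.$$ Let $$\mathcal D_1=\{0\le c<\sqrt2,\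 0<\kappa<\tfrac12\},\quad \mathcal D_3=\{c>\sqrt2,\ \kappa>\tfrac12\},\quad \mathcal B_-=\{c=\sqrt2,\ 0<\kappa<\tfrac12\},\quad \mathcal B_+=\{c=\sqrt2,\ \kappa>\tfrac12\},$$ and $\tilde{\mathcal D}=\mathcal D_1\cup\mathcal D_3\cup\mathcal B_-\cup\mathcal B_+$. Let $I_\kappa=[1-\frac1{2\kappa},0)$ if $0<\kappa<\frac12$ and $I_\kappa=(0,1-\frac1{2\kappa}]$ if $\kappa>\frac12$. For $(c,\kappa)\in\tilde{\mathcal D}$ and $y\in I_\kappa$ put $$F(y)=2\sqrt\kappa\,\mathrm{atan}\Big(\sqrt\kappa\sqrt{\tfrac{2-c^2-2y}{1-2\kappa+2\kappa y}}\Big)+2\sqrt{\tfrac{1-2\kappa}{2-c^2}}\,\mathrm{atanh}\Big(\sqrt{\tfrac{(2-c^2)(1-2\kappa+2\kappa y)}{(1-2\kappa)(2-c^2-2y)}}\Big)-\pi\sqrt\kappa\quad\text{if }c\ne\sqrt2,$$ $$F(y)=2\sqrt\kappa\,\mathrm{atan}\Big(\sqrt{\tfrac{-2\kappa y}{1-2\kappa+2\kappa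 y}}\Big)+\sqrt2\sqrt{-\tfrac{1-2\kappa+2\kappa y}{y}}-\pi\sqrt\kappa\quad\text{if }c=\sqrt2,$$ where at the endpoint $y=1-\frac1{2\kappa}$ the arctangent is read as $\pi/2$. Let $(c,\kappa)\in\tilde{\mathcal D}$. Then: 1. $F$ is a bijection from $I_\kappa$ onto $[0,\infty)$. Set $\eta(x)=F^{-1}(|x|)$, $\theta(x)=\frac c2\int_0^x\frac{\eta(y)}{1-\eta(y)}\,dy$ and $U=\sqrt{1-\eta}\,e^{i\theta}$ on $\mathbb R$. 2. $U\in\mathcal X(\mathbb R)$, and $U$ is a nontrivial weak solution of $(\mathrm{TW}(c,\kappa))$ with $\Gamma(U)=\{0\}$. 3. If $u\in\mathcal X(\mathbb R)$ is a nontrivial weak solution of $(\mathrm{TW}(c,\kappa))$ with $\Gamma(u)=\{0\}$, then there is $\varphi\in\mathbb R$ such that $u(x)=e^{i\varphi}U(x)$ for all $x\in\mathbb R$, and $\mathcal N(u)=\{0\}$. -/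

import Mathlib

open scoped ContDiff

namespace Cuspon

noncomputable section

/-! ### Function spaces and weak solutions -/

/-- `v` is the weak (distributional) derivative of `u` on the real line. -/
def IsWeakDeriv (u v : ℝ → ℂ) : Prop :=
  MeasureTheory.LocallyIntegrable u ∧ MeasureTheory.LocallyIntegrable v ∧
    ∀ φ : ℝ → ℝ, ContDiff ℝ ∞ φ → HasCompactSupport φ →
      ∫ x, ((deriv φ x : ℝ) : ℂ) * u x = -∫ x, ((φ x : ℝ) : ℂ) * v x

/-- The energy space `{u ∈ H¹_loc(ℝ) : 1 - |u|² ∈ L²(ℝ), u' ∈ L²(ℝ)}`. Its elements are represented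
by their continuous representatives, so that pointwise values of `u` make sense; `u` and `u'` are
then automatically locally square integrable. -/
def MemEnergySpace (u : ℝ → ℂ) : Prop :=
  Continuous u ∧
    MeasureTheory.MemLp (fun x => 1 - ‖u x‖ ^ 2) 2 MeasureTheory.volume ∧
    ∃ v : ℝ → ℂ, IsWeakDeriv u v ∧ MeasureTheory.MemLp v 2 MeasureTheory.volume

/-- `u` is a weak solution of `i c u' + u'' + u (1 - |u|²) + κ u (1 - |u|²)'' = 0` on the real line:
with `v = u'` (unique up to null sets) and `⟨z, w⟩ = Re z Re w + Im z Im w`,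
`∫ ⟨i c u' + u (1 - |u|²), φ⟩ - ⟨u', φ'⟩ + 2 κ ⟨u, u'⟩ ⟨u, φ⟩' = 0` for all `φ ∈ C_c^∞(ℝ; ℂ)`,
where `⟨u, φ⟩' = ⟨u', φ⟩ + ⟨u, φ'⟩`. -/
def IsWeakSolution (c κ : ℝ) (u : ℝ → ℂ) : Prop :=
  ∃ v : ℝ → ℂ, IsWeakDeriv u v ∧
    ∀ φ : ℝ → ℂ, ContDiff ℝ ∞ φ → HasCompactSupport φ →
      ∫ x, (inner ℝ (Complex.I * (c : ℂ) * v x + u x * ((1 - ‖u x‖ ^ 2 : ℝ) : ℂ)) (φ x)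
        - inner ℝ (v x) (deriv φ x)
        + 2 * κ * inner ℝ (u x) (v x) * (inner ℝ (v x) (φ x) + inner ℝ (u x) (deriv φ x))) = 0

/-- Trivial solutions: the constants of modulus one. -/
def IsTrivial (u : ℝ → ℂ) : Prop :=
  ∃ φ : ℝ, ∀ x, u x = Complex.exp (Complex.I * (φ : ℂ))

/-- The singular set `Γ(u) = {x : |u(x)|² = 1/(2κ)}`. -/
def singularSet (κ : ℝ) (u : ℝ → ℂ) : Set ℝ := {x | ‖u x‖ ^ 2 = 1 / (2 * κ)}

/-- The set `N(u)` of points where `u` is not differentiable in the classical sense. -/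
def nonDiffSet (u : ℝ → ℂ) : Set ℝ := {x | ¬ DifferentiableAt ℝ u x}

/-! ### Parameter regions -/

def regionD1 : Set (ℝ × ℝ) := {p | 0 ≤ p.1 ∧ p.1 < √2 ∧ 0 < p.2 ∧ p.2 < 1 / 2}

def regionD3 : Set (ℝ × ℝ) := {p | √2 < p.1 ∧ 1 / 2 < p.2}

def regionBminus : Set (ℝ × ℝ) := {p | p.1 = √2 ∧ 0 < p.2 ∧ p.2 < 1 / 2}

def regionBplus : Set (ℝ × ℝ) := {p | p.1 = √2 ∧ 1 / 2 < p.2}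

/-- The region `D̃ = D₁ ∪ D₃ ∪ B₋ ∪ B₊` of pairs `(c, κ)`. -/
def regionDtilde : Set (ℝ × ℝ) := regionD1 ∪ regionD3 ∪ regionBminus ∪ regionBplus

/-! ### The explicit profile -/

/-- The interval of values of the profile: `[1 - 1/(2κ), 0)` if `κ < 1/2` (antidark case), and
`(0, 1 - 1/(2κ)]` if `κ > 1/2` (dark case). -/
def profileRange (κ : ℝ) : Set ℝ :=
  if κ < 1 / 2 then Set.Ico (1 - 1 / (2 * κ)) 0 else Set.Ioc 0 (1 - 1 / (2 * κ))

/-- `atan √(a / b)`, with the convention `atan (+∞) = π/2` when the denominator `b` vanishes. -/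
def arctanSqrtDiv (a b : ℝ) : ℝ :=
  if b = 0 then Real.pi / 2 else Real.arctan (√(a / b))

/-- The function `f_{c,κ}` (also called `h_{c,κ}` when `κ > 1/2`), for `c ≠ √2`:
`2√κ atan(√κ √((2-c²-2y)/(1-2κ+2κy)))
  + 2√((1-2κ)/(2-c²)) atanh(√((2-c²)(1-2κ+2κy)/((1-2κ)(2-c²-2y)))) - π√κ`. -/
def cuspF (c κ y : ℝ) : ℝ :=
  2 * √κ * arctanSqrtDiv (κ * (2 - c ^ 2 - 2 * y)) (1 - 2 * κ + 2 * κ * y)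
    + 2 * √((1 - 2 * κ) / (2 - c ^ 2)) *
      Real.artanh (√((2 - c ^ 2) * (1 - 2 * κ + 2 * κ * y) /
        ((1 - 2 * κ) * (2 - c ^ 2 - 2 * y))))
    - Real.pi * √κ

/-- The function `g_κ` (also called `g̃_κ` when `κ > 1/2`), for `c = √2`:
`2√κ atan(√(-2κy/(1-2κ+2κy))) + √2 √(-(1-2κ+2κy)/y) - π√κ`. -/
def cuspG (κ y : ℝ) : ℝ :=
  2 * √κ * arctanSqrtDiv (-2 * κ * y) (1 - 2 * κ + 2 * κ * y)
    + √2 * √(-(1 - 2 * κ + 2 * κ * y) / y)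
    - Real.pi * √κ

/-- The function whose inverse is the profile on `[0, ∞)`. -/
def cuspFun (c κ : ℝ) : ℝ → ℝ := if c = √2 then cuspG κ else cuspF c κ

/-- The intensity profile `η_{c,κ}`: the inverse of `cuspFun c κ : profileRange κ → [0, ∞)`, extended
to an even function on the real line. -/
def cuspProfile (c κ x : ℝ) : ℝ := Function.invFunOn (cuspFun c κ) (profileRange κ) |x|

/-- The phase `θ_{c,κ}(x) = (c/2) ∫₀ˣ η/(1-η)`. -/
def cuspPhase (c κ x : ℝ) : ℝ :=
  c / 2 * ∫ y in (0 : ℝ)..x, cuspProfile c κ y / (1 - cuspProfile c κ y)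

/-- The cuspon `√(1-η_{c,κ}) e^{iθ_{c,κ}}`. -/
def cuspon (c κ : ℝ) (x : ℝ) : ℂ :=
  ((√(1 - cuspProfile c κ x) : ℝ) : ℂ) * Complex.exp (Complex.I * (cuspPhase c κ x : ℂ))

end

end Cuspon

open scoped Topology

namespace Cuspon

noncomputable section

open MeasureTheory

/-! ### The travel-time function and its inverse -/

/-! Put `A = (2 - c²) / (1 - 2κ)`. All four parameter regions lie in `A ≥ 0`, with `A = 0` exactly
when `c = √2`, so one argument covers them.

Write `η = 1 - |u|²`. The profile equation is `η'² (1 - 2κ + 2κη) = η² (2 - c² - 2η)`. With `t² = (1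
- 2κ + 2κη) / (2 - c² - 2η)`, `t` having the sign of `x`, it becomes `η' = -η / t`, and the position
is an explicit function `x = T(t)`, the `travelTime`. `T` increases strictly from `A t² < 1` onto
the line, and `T'` vanishes only at `t = 0`. Since `F` composed with `profileValue` is `T` for `t ≥
0` (`cuspFun_profileValue`), the bijectivity of `F` follows, and the cuspon is explicit in `t =
timeInv κ A x`.

Existence: the weak equation says that the flux `W = u' - 2κ⟨u, u'⟩u` has weak derivative `-(icu' +
u(1 - |u|²) + 2κ⟨u, u'⟩u')`. For the cuspon `U'` blows up like `1 / t` at the origin, but these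
singular terms cancel in `W`, which is continuous; hence the equation off the origin is the weak
equation on the whole line. The energy is finite because its density is dominated by `(1 - A t²) /
t²`, a multiple of the `x`-derivative of the bounded function `arctan (t / √κ)`.

Uniqueness: by du Bois-Reymond the flux of any solution is continuous, and `⟨u, W⟩ = (1 - 2κ|u|²)⟨u,
u'⟩` recovers `u'` from it off the singular set, so `u` is a classical solution there
(`exists_classical_derivatives`). Two first integrals, momentum and energy, have constant zero by
finite energy; together they give the profile equation, which `eq_profileValue_timeInv` solves on a
half-line. Reflection, which replaces `c` by `-c`, gives the other half-line. Then `u' / u = U' / U`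
off the origin, so the continuous function `u / U` is a constant, of modulus one. Differentiability
fails at the origin because `η' = -η / t` is unbounded there. -/

/-- The primitive of `1 / (1 - A t²)` vanishing at `0`, for `A ≥ 0`. -/
def artanhScaled (A t : ℝ) : ℝ := if A = 0 then t else Real.artanh (√A * t) / √A

/-- The domain `A t² < 1` of the travel time. -/
def timeDomain (A : ℝ) : Set ℝ := {t | A * t ^ 2 < 1}

/-- The position at which the cuspon with parameters `κ`, `A = (2 - c²) / (1 - 2κ)` takes the
value of index `t`. -/
def travelTime (κ A t : ℝ) : ℝ := 2 * artanhScaled A t - 2 * √κ * Real.arctan (t / √κ)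

theorem hasDerivAt_artanh {x : ℝ} (hx : x ∈ Set.Ioo (-1 : ℝ) 1) :
    HasDerivAt Real.artanh (1 / (1 - x ^ 2)) x := by
  obtain ⟨h1, h2⟩ := hx
  have h1' : (0 : ℝ) < 1 + x := by linarith
  have h2' : (0 : ℝ) < 1 - x := by linarith
  have h : HasDerivAt (fun y : ℝ => 1 / 2 * Real.log ((1 + y) / (1 - y))) (1 / (1 - x ^ 2)) x := by
    have hd := ((((hasDerivAt_id' x).const_add 1).fun_div ((hasDerivAt_id' x).const_sub 1)
      h2'.ne').log (by positivity)).const_mul (1 / 2)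
    refine hd.congr_deriv ?_
    have : 1 - x ^ 2 = (1 + x) * (1 - x) := by ring
    rw [this]
    field_simp
    ring
  refine h.congr_of_eventuallyEq ?_
  filter_upwards [Ioo_mem_nhds h1 h2] with y hy
  exact Real.artanh_eq_half_log ⟨hy.1.le, hy.2.le⟩

theorem sqrt_mul_mem_Ioo {A t : ℝ} (hA : 0 ≤ A) (ht : t ∈ timeDomain A) :
    √A * t ∈ Set.Ioo (-1 : ℝ) 1 := by
  have h : A * t ^ 2 < 1 := ht
  rw [Set.mem_Ioo, ← abs_lt, ← sq_lt_one_iff_abs_lt_one, mul_pow, Real.sq_sqrt hA]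
  exact h

theorem hasDerivAt_artanhScaled {A t : ℝ} (hA : 0 ≤ A) (ht : t ∈ timeDomain A) :
    HasDerivAt (artanhScaled A) (1 / (1 - A * t ^ 2)) t := by
  unfold artanhScaled
  rcases eq_or_ne A 0 with rfl | h
  · simpa using hasDerivAt_id' t
  · have hs : √A ≠ 0 := by rw [Real.sqrt_ne_zero hA]; exact h
    simp only [h, if_false]
    have h2 := (hasDerivAt_artanh (sqrt_mul_mem_Ioo hA ht)).comp t
      ((hasDerivAt_id' t).const_mul (√A))
    have h3 := h2.div_const (√A)
    refine h3.congr_deriv ?_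
    rw [mul_pow, Real.sq_sqrt hA]
    field_simp

theorem artanh_neg_eq {x : ℝ} (hx : x ∈ Set.Ioo (-1 : ℝ) 1) :
    Real.artanh (-x) = - Real.artanh x := by
  rw [← Real.tanh_artanh hx, ← Real.tanh_neg, Real.artanh_tanh, Real.artanh_tanh]

theorem artanhScaled_neg {A t : ℝ} (hA : 0 ≤ A) (ht : t ∈ timeDomain A) :
    artanhScaled A (-t) = - artanhScaled A t := by
  unfold artanhScaled
  split_ifs
  · rfl
  · rw [mul_neg, artanh_neg_eq (sqrt_mul_mem_Ioo hA ht), neg_div]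

theorem exists_artanhScaled_eq {A : ℝ} (hA : 0 ≤ A) (s : ℝ) :
    ∃ t ∈ timeDomain A, artanhScaled A t = s := by
  unfold artanhScaled timeDomain
  rcases hA.eq_or_lt with rfl | h
  · exact ⟨s, by simp, by simp⟩
  · have hs : 0 < √A := Real.sqrt_pos.2 h
    refine ⟨Real.tanh (√A * s) / √A, ?_, ?_⟩
    · simp only [Set.mem_ofPred_eq, div_pow, Real.sq_sqrt hA]
      rw [mul_div_cancel₀ _ h.ne', sq_lt_one_iff_abs_lt_one, abs_lt]
      exact ⟨Real.neg_one_lt_tanh _, Real.tanh_lt_one _⟩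
    · simp only [h.ne', if_false]
      rw [mul_div_cancel₀ _ hs.ne', Real.artanh_tanh, mul_div_cancel_left₀ _ hs.ne']

theorem isOpen_timeDomain (A : ℝ) : IsOpen (timeDomain A) :=
  isOpen_lt (by fun_prop) continuous_const

theorem neg_mem_timeDomain {A t : ℝ} (ht : t ∈ timeDomain A) : -t ∈ timeDomain A := by
  simpa [timeDomain] using ht

theorem zero_mem_timeDomain (A : ℝ) : (0 : ℝ) ∈ timeDomain A := by simp [timeDomain]

theorem ordConnected_timeDomain {A : ℝ} (hA : 0 ≤ A) : (timeDomain A).OrdConnected := by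
  refine ⟨fun x hx y hy z hz => ?_⟩
  simp only [timeDomain, Set.mem_ofPred_eq] at *
  have h1 : z ^ 2 ≤ max (x ^ 2) (y ^ 2) := by
    rcases le_total 0 z with h | h
    · exact le_max_of_le_right (by nlinarith [hz.1, hz.2])
    · exact le_max_of_le_left (by nlinarith [hz.1, hz.2])
  rcases le_max_iff.1 h1 with h | h <;> nlinarith

theorem travelTime_neg {κ A t : ℝ} (hA : 0 ≤ A) (ht : t ∈ timeDomain A) :
    travelTime κ A (-t) = - travelTime κ A t := by
  unfold travelTime
  rw [artanhScaled_neg hA ht, neg_div, Real.arctan_neg]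
  ring

theorem travelTime_zero {κ A : ℝ} (hA : 0 ≤ A) : travelTime κ A 0 = 0 := by
  have := travelTime_neg (κ := κ) hA (zero_mem_timeDomain A)
  rw [neg_zero] at this
  linarith

theorem hasDerivAt_arctan_div_sqrt {κ : ℝ} (hκ : 0 < κ) (t : ℝ) :
    HasDerivAt (fun t => Real.arctan (t / √κ)) (√κ / (κ + t ^ 2)) t := by
  have hs : 0 < √κ := Real.sqrt_pos.2 hκ
  refine ((hasDerivAt_id' t).div_const (√κ)).arctan.congr_deriv ?_
  field_simp
  rw [Real.sq_sqrt hκ.le]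

theorem hasDerivAt_travelTime {κ A t : ℝ} (hκ : 0 < κ) (hA : 0 ≤ A) (ht : t ∈ timeDomain A) :
    HasDerivAt (travelTime κ A) (2 * t ^ 2 * (1 + A * κ) / ((κ + t ^ 2) * (1 - A * t ^ 2))) t := by
  have h := ((hasDerivAt_artanhScaled hA ht).const_mul 2).sub
    ((hasDerivAt_arctan_div_sqrt hκ t).const_mul (2 * √κ))
  refine h.congr_deriv ?_
  have h1 : 1 - A * t ^ 2 ≠ 0 := by have : A * t ^ 2 < 1 := ht; linarith
  have h2 : κ + t ^ 2 ≠ 0 := by positivity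
  have h3 : 2 * √κ * (√κ / (κ + t ^ 2)) = 2 * κ / (κ + t ^ 2) := by
    rw [← mul_div_assoc, mul_assoc, Real.mul_self_sqrt hκ.le]
  rw [h3]
  field_simp
  ring

/-- The derivative is positive except at `t = 0`, where it vanishes; monotonicity is proved on each
side and joined at `0`. -/
theorem strictMonoOn_travelTime {κ A : ℝ} (hκ : 0 < κ) (hA : 0 ≤ A) :
    StrictMonoOn (travelTime κ A) (timeDomain A) := by
  have key : ∀ x ∈ timeDomain A, ∀ y ∈ timeDomain A, x < y → (0 ≤ x ∨ y ≤ 0) →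
      travelTime κ A x < travelTime κ A y := by
    intro x hx y hy hxy h0
    have hsub : Set.Icc x y ⊆ timeDomain A := (ordConnected_timeDomain hA).out hx hy
    refine strictMonoOn_of_deriv_pos (convex_Icc x y)
      (fun t ht => (hasDerivAt_travelTime hκ hA (hsub ht)).continuousAt.continuousWithinAt)
      (fun t ht => ?_) (Set.left_mem_Icc.2 hxy.le) (Set.right_mem_Icc.2 hxy.le) hxy
    rw [interior_Icc] at ht
    have htd := hsub (Set.Ioo_subset_Icc_self ht)
    rw [(hasDerivAt_travelTime hκ hA htd).deriv]
    have h1 : 0 < 1 - A * t ^ 2 := by have : A * t ^ 2 < 1 := htd; linarith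
    have h2 : t ≠ 0 := by
      rcases h0 with h0 | h0
      · exact (h0.trans_lt ht.1).ne'
      · exact (ht.2.trans_le h0).ne
    positivity
  intro x hx y hy hxy
  by_cases h : 0 ≤ x ∨ y ≤ 0
  · exact key x hx y hy hxy h
  · push Not at h
    exact (key x hx 0 (zero_mem_timeDomain A) h.1 (Or.inr le_rfl)).trans
      (key 0 (zero_mem_timeDomain A) y hy h.2 (Or.inl le_rfl))

theorem exists_travelTime_eq (κ : ℝ) {A : ℝ} (hκ : 0 < κ) (hA : 0 ≤ A) (x : ℝ) :
    ∃ t ∈ timeDomain A, travelTime κ A t = x := by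
  -- The arctangent term is at most `√κ π` in absolute value; shifting the other term by this amount
  -- brackets `x`.
  obtain ⟨t₁, h₁, e₁⟩ := exists_artanhScaled_eq hA ((x - √κ * Real.pi) / 2)
  obtain ⟨t₂, h₂, e₂⟩ := exists_artanhScaled_eq hA ((x + √κ * Real.pi) / 2)
  have hs : 0 ≤ 2 * √κ := by positivity
  have hc : ContinuousOn (travelTime κ A) (timeDomain A) :=
    fun t ht => (hasDerivAt_travelTime hκ hA ht).continuousAt.continuousWithinAt
  refine (ordConnected_timeDomain hA).isPreconnected.intermediate_value h₁ h₂ hc ⟨?_, ?_⟩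
  · unfold travelTime
    rw [e₁]
    have := mul_le_mul_of_nonneg_left (Real.neg_pi_div_two_lt_arctan (t₁ / √κ)).le hs
    linarith
  · unfold travelTime
    rw [e₂]
    have := mul_le_mul_of_nonneg_left (Real.arctan_lt_pi_div_two (t₂ / √κ)).le hs
    linarith

/-- The inverse of the travel time (for `κ > 0` and `A ≥ 0`). -/
def timeInv (κ A : ℝ) : ℝ → ℝ := Function.invFunOn (travelTime κ A) (timeDomain A)

theorem timeInv_mem {κ A : ℝ} (hκ : 0 < κ) (hA : 0 ≤ A) (x : ℝ) : timeInv κ A x ∈ timeDomain A :=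
  Function.invFunOn_mem (exists_travelTime_eq κ hκ hA x)

theorem travelTime_timeInv {κ A : ℝ} (hκ : 0 < κ) (hA : 0 ≤ A) (x : ℝ) :
    travelTime κ A (timeInv κ A x) = x :=
  Function.invFunOn_eq (exists_travelTime_eq κ hκ hA x)

theorem timeInv_travelTime {κ A t : ℝ} (hκ : 0 < κ) (hA : 0 ≤ A) (ht : t ∈ timeDomain A) :
    timeInv κ A (travelTime κ A t) = t :=
  (strictMonoOn_travelTime hκ hA).injOn (timeInv_mem hκ hA _) ht (travelTime_timeInv hκ hA _)

theorem timeInv_zero {κ A : ℝ} (hκ : 0 < κ) (hA : 0 ≤ A) : timeInv κ A 0 = 0 := by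
  conv_lhs => rw [← travelTime_zero (κ := κ) hA]
  exact timeInv_travelTime hκ hA (zero_mem_timeDomain A)

theorem timeInv_neg {κ A : ℝ} (hκ : 0 < κ) (hA : 0 ≤ A) (x : ℝ) :
    timeInv κ A (-x) = - timeInv κ A x := by
  conv_lhs => rw [← travelTime_timeInv hκ hA x, ← travelTime_neg hA (timeInv_mem hκ hA x)]
  exact timeInv_travelTime hκ hA (neg_mem_timeDomain (timeInv_mem hκ hA x))

theorem strictMono_timeInv {κ A : ℝ} (hκ : 0 < κ) (hA : 0 ≤ A) : StrictMono (timeInv κ A) := by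
  intro x y hxy
  rw [← (strictMonoOn_travelTime hκ hA).lt_iff_lt (timeInv_mem hκ hA x) (timeInv_mem hκ hA y),
    travelTime_timeInv hκ hA, travelTime_timeInv hκ hA]
  exact hxy

theorem timeInv_pos {κ A x : ℝ} (hκ : 0 < κ) (hA : 0 ≤ A) (hx : 0 < x) : 0 < timeInv κ A x := by
  simpa [timeInv_zero hκ hA] using strictMono_timeInv hκ hA hx

theorem timeInv_ne_zero {κ A x : ℝ} (hκ : 0 < κ) (hA : 0 ≤ A) (hx : x ≠ 0) :
    timeInv κ A x ≠ 0 := by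
  rw [← timeInv_zero hκ hA]
  exact (strictMono_timeInv hκ hA).injective.ne hx

/-- The critical point of `travelTime` at `0` rules out a proof through the inverse function
theorem; monotonicity and an open image suffice. -/
theorem continuous_timeInv {κ A : ℝ} (hκ : 0 < κ) (hA : 0 ≤ A) : Continuous (timeInv κ A) := by
  rw [continuous_iff_continuousAt]
  intro x
  refine continuousAt_of_monotoneOn_of_image_mem_nhds (s := Set.univ)
    ((strictMono_timeInv hκ hA).monotone.monotoneOn _) Filter.univ_mem ?_
  refine Filter.mem_of_superset ((isOpen_timeDomain A).mem_nhds (timeInv_mem hκ hA x)) ?_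
  exact fun t ht => ⟨travelTime κ A t, trivial, timeInv_travelTime hκ hA ht⟩

theorem hasDerivAt_timeInv {κ A x : ℝ} (hκ : 0 < κ) (hA : 0 ≤ A) (hx : x ≠ 0) :
    HasDerivAt (timeInv κ A) ((κ + timeInv κ A x ^ 2) * (1 - A * timeInv κ A x ^ 2) /
      (2 * timeInv κ A x ^ 2 * (1 + A * κ))) x := by
  have ht := timeInv_ne_zero hκ hA hx
  have hm := timeInv_mem hκ hA x
  have h1 : 0 < 1 - A * timeInv κ A x ^ 2 := by
    have : A * timeInv κ A x ^ 2 < 1 := hm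
    linarith
  have h := HasDerivAt.of_local_left_inverse (continuous_timeInv hκ hA).continuousAt
    (hasDerivAt_travelTime hκ hA hm) (by positivity)
    (Filter.Eventually.of_forall (travelTime_timeInv hκ hA))
  rwa [inv_div] at h

/-! ### The profile as a function of the travel-time index -/

/-- The value of the profile at index `t`. -/
def profileValue (κ A t : ℝ) : ℝ := (1 - 2 * κ) * (A * t ^ 2 - 1) / (2 * (κ + t ^ 2))

theorem one_sub_profileValue {c κ A : ℝ} (hκ : 0 < κ) (hc : c ^ 2 = 2 - (1 - 2 * κ) * A) (t : ℝ) :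
    1 - profileValue κ A t = (1 + c ^ 2 * t ^ 2) / (2 * (κ + t ^ 2)) := by
  unfold profileValue
  have : κ + t ^ 2 ≠ 0 := by positivity
  rw [hc]
  field_simp
  ring

theorem hasDerivAt_profileValue {κ A : ℝ} (hκ : 0 < κ) (t : ℝ) :
    HasDerivAt (profileValue κ A) ((1 - 2 * κ) * (1 + A * κ) * t / (κ + t ^ 2) ^ 2) t := by
  have h0 : κ + t ^ 2 ≠ 0 := by positivity
  have h1 := ((((hasDerivAt_pow 2 t).const_mul A).sub_const 1).const_mul (1 - 2 * κ)).div
    (((hasDerivAt_pow 2 t).const_add κ).const_mul 2) (by positivity)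
  refine h1.congr_deriv ?_
  field_simp
  push_cast
  ring

/-- With `profileValue_numer`, this shows that `profileValue` inverts the substitution `t² = (1 - 2κ
+ 2κη) / (2 - c² - 2η)`. The index `t = 0` corresponds to `|u|² = 1 / (2κ)`. -/
theorem profileValue_denom {κ A : ℝ} (hκ : 0 < κ) (t : ℝ) :
    1 - 2 * κ + 2 * κ * profileValue κ A t
      = t ^ 2 * ((1 - 2 * κ) * (1 + A * κ) / (κ + t ^ 2)) := by
  unfold profileValue
  have : κ + t ^ 2 ≠ 0 := by positivity
  field_simp
  ring

theorem profileValue_numer {κ A : ℝ} (hκ : 0 < κ) (t : ℝ) :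
    (1 - 2 * κ) * A - 2 * profileValue κ A t = (1 - 2 * κ) * (1 + A * κ) / (κ + t ^ 2) := by
  unfold profileValue
  have : κ + t ^ 2 ≠ 0 := by positivity
  field_simp
  ring

theorem exists_ratio_of_mem_regionDtilde {c κ : ℝ} (h : (c, κ) ∈ regionDtilde) :
    0 < κ ∧ 1 - 2 * κ ≠ 0 ∧ 0 ≤ c ∧ ∃ A, 0 ≤ A ∧ c ^ 2 = 2 - (1 - 2 * κ) * A := by
  have h2 : (0 : ℝ) ≤ √2 := Real.sqrt_nonneg 2
  have h3 : √2 ^ 2 = (2 : ℝ) := Real.sq_sqrt (by norm_num)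
  suffices H : 0 < κ ∧ 1 - 2 * κ ≠ 0 ∧ 0 ≤ c ∧ 0 ≤ (2 - c ^ 2) / (1 - 2 * κ) by
    refine ⟨H.1, H.2.1, H.2.2.1, _, H.2.2.2, ?_⟩
    rw [mul_div_cancel₀ _ H.2.1]
    ring
  rcases h with ((⟨h0, h1, h4, h5⟩ | ⟨h1, h4⟩) | ⟨h1, h4, h5⟩) | ⟨h1, h4⟩ <;> dsimp only at *
  · exact ⟨h4, by linarith, h0, div_nonneg (by nlinarith) (by linarith)⟩
  · exact ⟨by linarith, by linarith, by linarith, div_nonneg_of_nonpos (by nlinarith) (by linarith)⟩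
  · subst h1
    exact ⟨h4, by linarith, h2, by simp [h3]⟩
  · subst h1
    exact ⟨by linarith, by linarith, h2, by simp [h3]⟩

/-- The factor `1 - 2κ` absorbs the sign that separates the antidark from the dark case. -/
theorem mem_profileRange_iff {κ y : ℝ} (hκ : 0 < κ) (hb : 1 - 2 * κ ≠ 0) :
    y ∈ profileRange κ ↔ (1 - 2 * κ) * y < 0 ∧ 0 ≤ (1 - 2 * κ) * (1 - 2 * κ + 2 * κ * y) := by
  have e : 2 * κ * (1 - 1 / (2 * κ)) = 2 * κ - 1 := by field_simp
  unfold profileRange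
  split_ifs with h
  · have hb' : 0 < 1 - 2 * κ := by linarith
    have h1 : (1 - 2 * κ) * y < 0 ↔ y < 0 :=
      ⟨fun h => by by_contra h'; nlinarith, mul_neg_of_pos_of_neg hb'⟩
    rw [Set.mem_Ico, mul_nonneg_iff_of_pos_left hb', h1, and_comm,
      ← mul_le_mul_iff_right₀ (show 0 < 2 * κ by positivity), e]
    exact and_congr_right fun _ => by constructor <;> intro <;> linarith
  · have hb' : 1 - 2 * κ < 0 := lt_of_le_of_ne (by linarith) hb
    have h1 : (1 - 2 * κ) * y < 0 ↔ 0 < y := by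
      constructor
      · intro h; by_contra h'; nlinarith
      · intro h; nlinarith
    have h2 : 0 ≤ (1 - 2 * κ) * (1 - 2 * κ + 2 * κ * y) ↔ 1 - 2 * κ + 2 * κ * y ≤ 0 := by
      constructor
      · intro h; by_contra h'; nlinarith
      · intro h; nlinarith
    rw [Set.mem_Ioc, h1, h2, ← mul_le_mul_iff_right₀ (show 0 < 2 * κ by positivity), e]
    exact and_congr_right fun _ => by constructor <;> intro <;> linarith

theorem profileValue_mem {κ A t : ℝ} (hκ : 0 < κ) (hb : 1 - 2 * κ ≠ 0) (hA : 0 ≤ A)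
    (ht : t ∈ timeDomain A) : profileValue κ A t ∈ profileRange κ := by
  rw [mem_profileRange_iff hκ hb, profileValue_denom hκ]
  have h1 : 0 < 1 - A * t ^ 2 := by have : A * t ^ 2 < 1 := ht; linarith
  have hb2 : 0 < (1 - 2 * κ) ^ 2 := by positivity
  constructor
  · have : (1 - 2 * κ) * profileValue κ A t
        = - ((1 - 2 * κ) ^ 2 * (1 - A * t ^ 2) / (2 * (κ + t ^ 2))) := by
      unfold profileValue
      ring
    rw [this, neg_neg_iff_pos]
    positivity
  · have : (1 - 2 * κ) * (t ^ 2 * ((1 - 2 * κ) * (1 + A * κ) / (κ + t ^ 2)))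
        = (1 - 2 * κ) ^ 2 * t ^ 2 * (1 + A * κ) / (κ + t ^ 2) := by ring
    rw [this]
    positivity

theorem profileValue_of_sq {κ A t y : ℝ} (hκ : 0 < κ) (hA : 0 ≤ A)
    (hy : (1 - 2 * κ) * y < 0)
    (ht : t ^ 2 = (1 - 2 * κ + 2 * κ * y) / ((1 - 2 * κ) * A - 2 * y)) :
    t ∈ timeDomain A ∧ profileValue κ A t = y := by
  have hb : 1 - 2 * κ ≠ 0 := by rintro h; simp [h] at hy
  have hb2 : 0 < (1 - 2 * κ) ^ 2 := by positivity
  have hr' : 0 < (1 - 2 * κ) * ((1 - 2 * κ) * A - 2 * y) := by nlinarith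
  have hr : (1 - 2 * κ) * A - 2 * y ≠ 0 := by intro h; simp [h] at hr'
  have e : t ^ 2 * ((1 - 2 * κ) * A - 2 * y) = 1 - 2 * κ + 2 * κ * y := by
    rw [ht, div_mul_cancel₀ _ hr]
  constructor
  · by_contra h
    have h : 1 ≤ A * t ^ 2 := by simpa [timeDomain] using h
    have h1 : (1 - 2 * κ) * ((1 - 2 * κ) * A - 2 * y) * (A * t ^ 2 - 1)
        = 2 * (1 + A * κ) * ((1 - 2 * κ) * y) := by
      linear_combination A * (1 - 2 * κ) * e
    have h2 : 0 ≤ (1 - 2 * κ) * ((1 - 2 * κ) * A - 2 * y) * (A * t ^ 2 - 1) :=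
      mul_nonneg hr'.le (by linarith)
    have h3 : 2 * (1 + A * κ) * ((1 - 2 * κ) * y) < 0 :=
      mul_neg_of_pos_of_neg (by positivity) hy
    linarith
  · have h0 : 2 * (κ + t ^ 2) ≠ 0 := by positivity
    unfold profileValue
    rw [div_eq_iff h0]
    linear_combination e

theorem exists_profileValue_eq {κ A y : ℝ} (hκ : 0 < κ) (hb : 1 - 2 * κ ≠ 0) (hA : 0 ≤ A)
    (hy : y ∈ profileRange κ) : ∃ t ∈ timeDomain A, 0 ≤ t ∧ profileValue κ A t = y := by
  rw [mem_profileRange_iff hκ hb] at hy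
  have hb2 : 0 < (1 - 2 * κ) ^ 2 := by positivity
  have hr' : 0 < (1 - 2 * κ) * ((1 - 2 * κ) * A - 2 * y) := by nlinarith [hy.1]
  obtain ⟨h1, h2⟩ := profileValue_of_sq (t := √((1 - 2 * κ + 2 * κ * y) /
    ((1 - 2 * κ) * A - 2 * y))) hκ hA hy.1 (Real.sq_sqrt (by
      rw [← mul_div_mul_left _ _ hb]
      exact div_nonneg hy.2 hr'.le))
  exact ⟨_, h1, Real.sqrt_nonneg _, h2⟩

theorem arctanSqrtDiv_eq {κ t r : ℝ} (hκ : 0 < κ) (ht : 0 ≤ t) (hr : r ≠ 0) :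
    arctanSqrtDiv (κ * r) (t ^ 2 * r) = Real.pi / 2 - Real.arctan (t / √κ) := by
  unfold arctanSqrtDiv
  rcases ht.eq_or_lt with rfl | h
  · simp
  · rw [if_neg (by positivity), mul_div_mul_right _ _ hr, Real.sqrt_div hκ.le, Real.sqrt_sq ht,
      ← Real.arctan_inv_of_pos (by positivity), inv_div]

/-- The common factor `r` of numerators and denominators cancels, and `arctan s + arctan (1 / s) = π
/ 2` absorbs the term `-π√κ`. At `t = 0` the convention for a vanishing denominator is exactly what
makes this hold. -/
theorem cuspFun_profileValue {c κ A t : ℝ} (hκ : 0 < κ) (hb : 1 - 2 * κ ≠ 0) (hA : 0 ≤ A)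
    (hc0 : 0 ≤ c) (hc : c ^ 2 = 2 - (1 - 2 * κ) * A) (ht0 : 0 ≤ t) :
    cuspFun c κ (profileValue κ A t) = travelTime κ A t := by
  have hA1 : 0 < 1 + A * κ := by positivity
  have ht2 : 0 < κ + t ^ 2 := by positivity
  obtain ⟨r, hr⟩ : ∃ r, r = (1 - 2 * κ) * (1 + A * κ) / (κ + t ^ 2) := ⟨_, rfl⟩
  have hr0 : r ≠ 0 := by
    rw [hr]
    exact div_ne_zero (mul_ne_zero hb hA1.ne') ht2.ne'
  have e1 := profileValue_denom (A := A) hκ t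
  have e2 := profileValue_numer (A := A) hκ t
  rw [← hr] at e1 e2
  have hc2 : c = √2 ↔ A = 0 := by
    rw [← Real.sqrt_sq hc0, hc, Real.sqrt_inj (by rw [← hc]; positivity) (by norm_num)]
    constructor
    · intro h
      have : (1 - 2 * κ) * A = 0 := by linarith
      exact (mul_eq_zero.1 this).resolve_left hb
    · rintro rfl
      simp
  unfold cuspFun travelTime artanhScaled
  by_cases hA0 : A = 0
  · rw [if_pos (hc2.2 hA0), if_pos hA0]
    unfold cuspG
    rw [hA0, mul_zero, zero_sub] at e2
    have e3 : profileValue κ 0 t = -(r / 2) := by linarith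
    rw [hA0] at e1 ⊢
    rw [e1, e3, show -2 * κ * -(r / 2) = κ * r by ring, arctanSqrtDiv_eq hκ ht0 hr0,
      show -(t ^ 2 * r) / -(r / 2) = 2 * t ^ 2 by field_simp,
      Real.sqrt_mul (by norm_num), Real.sqrt_sq ht0, ← mul_assoc,
      Real.mul_self_sqrt (by norm_num)]
    ring
  · rw [if_neg (fun h => hA0 (hc2.1 h)), if_neg hA0]
    unfold cuspF
    have e4 : 2 - c ^ 2 = (1 - 2 * κ) * A := by linarith
    rw [e4, e1, e2, arctanSqrtDiv_eq hκ ht0 hr0,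
      show (1 - 2 * κ) / ((1 - 2 * κ) * A) = A⁻¹ by field_simp,
      show (1 - 2 * κ) * A * (t ^ 2 * r) / ((1 - 2 * κ) * r) = A * t ^ 2 by field_simp,
      Real.sqrt_inv, Real.sqrt_mul hA, Real.sqrt_sq ht0]
    ring

theorem travelTime_nonneg {κ A t : ℝ} (hκ : 0 < κ) (hA : 0 ≤ A) (ht : t ∈ timeDomain A)
    (h0 : 0 ≤ t) : 0 ≤ travelTime κ A t := by
  rw [← travelTime_zero (κ := κ) hA]
  exact (strictMonoOn_travelTime hκ hA).monotoneOn (zero_mem_timeDomain A) ht h0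

theorem timeInv_nonneg {κ A x : ℝ} (hκ : 0 < κ) (hA : 0 ≤ A) (hx : 0 ≤ x) :
    0 ≤ timeInv κ A x := by
  simpa [timeInv_zero hκ hA] using (strictMono_timeInv hκ hA).monotone hx

theorem bijOn_cuspFun {c κ A : ℝ} (hκ : 0 < κ) (hb : 1 - 2 * κ ≠ 0) (hA : 0 ≤ A)
    (hc0 : 0 ≤ c) (hc : c ^ 2 = 2 - (1 - 2 * κ) * A) :
    Set.BijOn (cuspFun c κ) (profileRange κ) (Set.Ici 0) := by
  refine ⟨fun y hy => ?_, fun y hy z hz h => ?_, fun x hx => ?_⟩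
  · obtain ⟨t, ht, h0, rfl⟩ := exists_profileValue_eq hκ hb hA hy
    rw [cuspFun_profileValue hκ hb hA hc0 hc h0]
    exact travelTime_nonneg hκ hA ht h0
  · obtain ⟨t, ht, h0, rfl⟩ := exists_profileValue_eq hκ hb hA hy
    obtain ⟨s, hs, h0', rfl⟩ := exists_profileValue_eq hκ hb hA hz
    rw [cuspFun_profileValue hκ hb hA hc0 hc h0, cuspFun_profileValue hκ hb hA hc0 hc h0'] at h
    rw [(strictMonoOn_travelTime hκ hA).injOn ht hs h]
  · refine ⟨profileValue κ A (timeInv κ A x), profileValue_mem hκ hb hA (timeInv_mem hκ hA x), ?_⟩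
    rw [cuspFun_profileValue hκ hb hA hc0 hc (timeInv_nonneg hκ hA hx), travelTime_timeInv hκ hA]

theorem cuspProfile_eq {c κ A : ℝ} (hκ : 0 < κ) (hb : 1 - 2 * κ ≠ 0) (hA : 0 ≤ A)
    (hc0 : 0 ≤ c) (hc : c ^ 2 = 2 - (1 - 2 * κ) * A) (x : ℝ) :
    cuspProfile c κ x = profileValue κ A (timeInv κ A x) := by
  have h : profileValue κ A (timeInv κ A x) = profileValue κ A (timeInv κ A |x|) := by
    rcases abs_choice x with h | h <;> rw [h]
    rw [timeInv_neg hκ hA]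
    simp [profileValue]
  have e : |x| = cuspFun c κ (profileValue κ A (timeInv κ A |x|)) := by
    rw [cuspFun_profileValue hκ hb hA hc0 hc (timeInv_nonneg hκ hA (abs_nonneg x)),
      travelTime_timeInv hκ hA]
  rw [h]
  unfold cuspProfile
  conv_lhs => rw [e]
  exact (bijOn_cuspFun hκ hb hA hc0 hc).injOn.leftInvOn_invFunOn
    (profileValue_mem hκ hb hA (timeInv_mem hκ hA |x|))

/-! ### Integration by parts and the lemma of du Bois-Reymond -/

/-- The boundary terms `±f a` of the two half-lines cancel by continuity, so a single exceptional
point carries no mass. -/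
theorem integral_eq_zero_of_hasDerivAt_of_ne {E : Type*} [NormedAddCommGroup E] [NormedSpace ℝ E]
    [CompleteSpace E] {f f' : ℝ → E} (a : ℝ) (hf : Continuous f) (hs : HasCompactSupport f)
    (hd : ∀ x, x ≠ a → HasDerivAt f (f' x) x) (hi : Integrable f') : ∫ x, f' x = 0 := by
  have h0 := hs.is_zero_at_infty
  rw [cocompact_eq_atBot_atTop, Filter.tendsto_sup] at h0
  have h1 := integral_Ioi_of_hasDerivAt_of_tendsto (a := a) hf.continuousWithinAt
    (fun x hx => hd x (ne_of_gt hx)) hi.integrableOn h0.2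
  have h2 := integral_Iic_of_hasDerivAt_of_tendsto (a := a) hf.continuousWithinAt
    (fun x hx => hd x (ne_of_lt hx)) hi.integrableOn h0.1
  rw [← intervalIntegral.integral_Iic_add_Ioi (b := a) hi.integrableOn hi.integrableOn, h1, h2]
  simp

theorem locallyIntegrable_of_norm_le_mul {E F : Type*} [NormedAddCommGroup E]
    [NormedAddCommGroup F] {f : ℝ → E} {g : ℝ → F} {k : ℝ → ℝ} (hk : Continuous k)
    (hf : LocallyIntegrable f) (hg : AEStronglyMeasurable g volume)
    (h : ∀ x, ‖g x‖ ≤ k x * ‖f x‖) : LocallyIntegrable g := by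
  have h1 : LocallyIntegrable (fun x => k x • ‖f x‖) := by
    have := (locallyIntegrableOn_univ.2 hf).norm
    exact (locallyIntegrableOn_univ.1 this).continuous_smul hk
  exact h1.mono hg (Filter.Eventually.of_forall fun x => (h x).trans (le_abs_self _))

/-- The primitive of a locally integrable function is only absolutely continuous, so the parts
formula is used in that class, on an interval containing the support of `φ`. -/
theorem integral_deriv_mul_primitive {g φ : ℝ → ℝ} (hg : LocallyIntegrable g)
    (hφ : ContDiff ℝ ∞ φ) (hs : HasCompactSupport φ) :
    ∫ x, deriv φ x * (∫ t in (0 : ℝ)..x, g t) = -∫ x, φ x * g x := by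
  obtain ⟨R, hR0, hR⟩ : ∃ R : ℝ, 0 < R ∧ ∀ x ∈ tsupport φ, |x| < R := by
    obtain ⟨R, hR⟩ := hs.isCompact.isBounded.subset_ball 0
    refine ⟨max R 1, by positivity, fun x hx => ?_⟩
    have := hR hx
    rw [Metric.mem_ball, dist_zero_right, Real.norm_eq_abs] at this
    exact this.trans_le (le_max_left _ _)
  have hz : ∀ x, R ≤ |x| → φ x = 0 := fun x hx => by
    by_contra h
    exact absurd (hR x (subset_tsupport _ h)) (not_lt.2 hx)
  have hIoc : ∀ x ∈ tsupport φ, x ∈ Set.Ioc (-R) R := fun x hx =>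
    ⟨(abs_lt.1 (hR x hx)).1, (abs_lt.1 (hR x hx)).2.le⟩
  have hle : -R ≤ R := by linarith
  have hgi : IntervalIntegrable g volume (-R) R :=
    intervalIntegrable_iff.2 ((hg.integrableOn_isCompact isCompact_uIcc).mono_set
      Set.uIoc_subset_uIcc)
  have hac1 : AbsolutelyContinuousOnInterval φ (-R) R :=
    ContDiffOn.absolutelyContinuousOnInterval
      ((hφ.of_le (by exact_mod_cast le_top)).contDiffOn)
  have hac2 : AbsolutelyContinuousOnInterval (fun x => ∫ t in (0 : ℝ)..x, g t) (-R) R :=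
    hgi.absolutelyContinuousOnInterval_intervalIntegral
      (by rw [Set.uIcc_of_le hle]; constructor <;> linarith)
  have h := hac1.integral_mul_deriv_eq_deriv_mul hac2
  rw [hz R (abs_of_pos hR0).ge, hz (-R) (by rw [abs_neg, abs_of_pos hR0])] at h
  rw [← intervalIntegral.integral_eq_integral_of_support_subset
      (a := -R) (b := R) (f := fun x => deriv φ x * (∫ t in (0 : ℝ)..x, g t)),
    ← intervalIntegral.integral_eq_integral_of_support_subset
      (a := -R) (b := R) (f := fun x => φ x * g x)]
  · have h' : ∫ x in (-R)..R, φ x * deriv (fun x => ∫ t in (0 : ℝ)..x, g t) x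
        = ∫ x in (-R)..R, φ x * g x := by
      refine intervalIntegral.integral_congr_ae ?_
      filter_upwards [LocallyIntegrable.ae_hasDerivAt_integral hg] with x hx _
      rw [(hx 0).deriv]
    rw [← h', h]
    ring
  · exact fun x hx => hIoc x (subset_tsupport _ (left_ne_zero_of_mul hx))
  · exact fun x hx => hIoc x (support_deriv_subset (left_ne_zero_of_mul hx))

theorem ae_eq_const_of_integral_deriv_mul_eq_zero {h : ℝ → ℝ} (hh : LocallyIntegrable h)
    (H : ∀ φ : ℝ → ℝ, ContDiff ℝ ∞ φ → HasCompactSupport φ → ∫ x, deriv φ x * h x = 0) :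
    ∃ C, ∀ᵐ x, h x = C := by
  let χ : ContDiffBump (0 : ℝ) := ⟨1, 2, by norm_num, by norm_num⟩
  have hχs : HasCompactSupport (χ.normed volume) := χ.hasCompactSupport_normed
  have hχd : ContDiff ℝ ∞ (χ.normed volume) := χ.contDiff_normed
  have hχi : ∫ x, χ.normed volume x = 1 := χ.integral_normed
  refine ⟨∫ x, χ.normed volume x * h x, ?_⟩
  set C := ∫ x, χ.normed volume x * h x
  have hz : ∀ᵐ x, h x - C = 0 := by
    refine ae_eq_zero_of_integral_contDiff_smul_eq_zero (hh.sub (locallyIntegrable_const C)) ?_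
    intro ψ hψ hψs
    -- Removing the mean with a normalized bump leaves a function of integral zero, whose primitive
    -- again has compact support and is an admissible test function.
    obtain ⟨ψ₀, hψ₀⟩ : ∃ ψ₀ : ℝ → ℝ, ψ₀ = fun x => ψ x - (∫ y, ψ y) * χ.normed volume x :=
      ⟨_, rfl⟩
    have hd0 : ContDiff ℝ ∞ ψ₀ := by rw [hψ₀]; exact hψ.sub (contDiff_const.mul hχd)
    have hs0 : HasCompactSupport ψ₀ := by rw [hψ₀]; exact hψs.sub hχs.mul_left
    have hψi : Integrable ψ := hψ.continuous.integrable_of_hasCompactSupport hψs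
    have hχint : Integrable (χ.normed volume) :=
      hχd.continuous.integrable_of_hasCompactSupport hχs
    have hi0 : ∫ x, ψ₀ x = 0 := by
      rw [hψ₀, integral_sub hψi (hχint.const_mul _), integral_const_mul, hχi]
      ring
    obtain ⟨R, hR⟩ : ∃ R : ℝ, ∀ x, ψ₀ x ≠ 0 → |x| < R := by
      obtain ⟨R, hR⟩ := hs0.isCompact.isBounded.subset_ball 0
      refine ⟨R, fun x hx => ?_⟩
      have := hR (subset_tsupport _ hx)
      rwa [Metric.mem_ball, dist_zero_right, Real.norm_eq_abs] at this
    have hder : ∀ x, HasDerivAt (fun x => ∫ t in (-R)..x, ψ₀ t) (ψ₀ x) x := fun x =>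
      (hd0.continuous.integral_hasStrictDerivAt _ _).hasDerivAt
    have hderiv : deriv (fun x => ∫ t in (-R)..x, ψ₀ t) = ψ₀ := funext fun x => (hder x).deriv
    have hcd : ContDiff ℝ ∞ (fun x => ∫ t in (-R)..x, ψ₀ t) := by
      rw [contDiff_infty_iff_deriv, hderiv]
      exact ⟨fun x => (hder x).differentiableAt, hd0⟩
    have hcs : HasCompactSupport (fun x => ∫ t in (-R)..x, ψ₀ t) := by
      refine HasCompactSupport.intro (isCompact_Icc (a := -R) (b := R)) fun x hx => ?_
      by_cases hxl : x < -R
      · refine (intervalIntegral.integral_congr (g := fun _ => 0) fun t ht => ?_).trans (by simp)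
        rw [Set.uIcc_of_ge hxl.le] at ht
        by_contra h
        exact absurd (abs_lt.1 (hR t h)).1 (not_lt.2 ht.2)
      · have hxr : R < x := by
          by_contra h'
          exact hx ⟨not_lt.1 hxl, not_lt.1 h'⟩
        rw [intervalIntegral.integral_eq_integral_of_support_subset, hi0]
        intro t ht
        have := abs_lt.1 (hR t ht)
        exact ⟨this.1, (this.2.trans hxr).le⟩
    have hH := H _ hcd hcs
    rw [hderiv, hψ₀] at hH
    have e1 : Integrable fun x => ψ x * h x :=
      hh.integrable_smul_left_of_hasCompactSupport hψ.continuous hψs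
    have e2 : Integrable fun x => χ.normed volume x * h x :=
      hh.integrable_smul_left_of_hasCompactSupport hχd.continuous hχs
    have e3 : ∫ x, (ψ x - (∫ y, ψ y) * χ.normed volume x) * h x
        = (∫ x, ψ x * h x) - (∫ y, ψ y) * C := by
      rw [← integral_const_mul, ← integral_sub e1 (e2.const_mul _)]
      congr 1 with x
      ring
    have e4 : ∫ x, ψ x • (h x - C) = (∫ x, ψ x * h x) - (∫ y, ψ y) * C := by
      rw [← integral_mul_const, ← integral_sub e1 (hψi.mul_const _)]
      congr 1 with x
      simp only [smul_eq_mul]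
      ring
    rw [e4, ← e3]
    exact hH
  filter_upwards [hz] with x hx
  linarith

theorem ae_eq_const_add_primitive {f g : ℝ → ℝ} (hf : LocallyIntegrable f)
    (hg : LocallyIntegrable g)
    (H : ∀ φ : ℝ → ℝ, ContDiff ℝ ∞ φ → HasCompactSupport φ →
      ∫ x, deriv φ x * f x = -∫ x, φ x * g x) :
    ∃ C, ∀ᵐ x, f x = C + ∫ t in (0 : ℝ)..x, g t := by
  have hint : ∀ a b, IntervalIntegrable g volume a b := fun a b =>
    intervalIntegrable_iff.2 ((hg.integrableOn_isCompact isCompact_uIcc).mono_set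
      Set.uIoc_subset_uIcc)
  have hGc : Continuous fun x => ∫ t in (0 : ℝ)..x, g t :=
    intervalIntegral.continuous_primitive hint 0
  obtain ⟨C, hC⟩ := ae_eq_const_of_integral_deriv_mul_eq_zero
    (hf.sub hGc.locallyIntegrable) (fun φ hφ hs => by
      have hdc : Continuous (deriv φ) := hφ.continuous_deriv (by exact_mod_cast le_top)
      have e1 : Integrable fun x => deriv φ x * f x :=
        hf.integrable_smul_left_of_hasCompactSupport hdc hs.deriv
      have e2 : Integrable fun x => deriv φ x * ∫ t in (0 : ℝ)..x, g t :=
        hGc.locallyIntegrable.integrable_smul_left_of_hasCompactSupport hdc hs.deriv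
      have e3 : (fun x => deriv φ x * (f - fun x => ∫ t in (0 : ℝ)..x, g t) x)
          = fun x => deriv φ x * f x - deriv φ x * ∫ t in (0 : ℝ)..x, g t := by
        funext x
        simp only [Pi.sub_apply]
        ring
      rw [e3, integral_sub e1 e2, H φ hφ hs, integral_deriv_mul_primitive hg hφ hs]
      ring)
  refine ⟨C, ?_⟩
  filter_upwards [hC] with x hx
  simp only [Pi.sub_apply] at hx
  linarith

/-! ### The cuspon in terms of the travel-time index -/

theorem one_sub_profileValue_pos {c κ A : ℝ} (hκ : 0 < κ)
    (hc : c ^ 2 = 2 - (1 - 2 * κ) * A) (t : ℝ) : 0 < 1 - profileValue κ A t := by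
  rw [one_sub_profileValue hκ hc]
  positivity

/-- The quotient `η / (1 - η)` at index `t`. -/
def profileRatio (κ A t : ℝ) : ℝ := profileValue κ A t / (1 - profileValue κ A t)

theorem hasDerivAt_profileValue_timeInv {κ A x : ℝ} (hκ : 0 < κ) (hA : 0 ≤ A) (hx : x ≠ 0) :
    HasDerivAt (fun x => profileValue κ A (timeInv κ A x))
      (-(profileValue κ A (timeInv κ A x) / timeInv κ A x)) x := by
  have ht := timeInv_ne_zero hκ hA hx
  refine ((hasDerivAt_profileValue hκ _).comp x (hasDerivAt_timeInv hκ hA hx)).congr_deriv ?_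
  unfold profileValue
  have : κ + timeInv κ A x ^ 2 ≠ 0 := by positivity
  have : 1 + A * κ ≠ 0 := by positivity
  field_simp
  ring

theorem hasDerivAt_profileRatio_timeInv {c κ A x : ℝ} (hκ : 0 < κ) (hA : 0 ≤ A)
    (hc : c ^ 2 = 2 - (1 - 2 * κ) * A) (hx : x ≠ 0) :
    HasDerivAt (fun x => profileRatio κ A (timeInv κ A x))
      (-(profileRatio κ A (timeInv κ A x) ^ 2 + profileRatio κ A (timeInv κ A x)) /
        timeInv κ A x) x := by
  have ht := timeInv_ne_zero hκ hA hx
  have h1 := (one_sub_profileValue_pos hκ hc (timeInv κ A x)).ne'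
  have h := hasDerivAt_profileValue_timeInv hκ hA hx
  refine (h.fun_div (h.const_sub 1) h1).congr_deriv ?_
  unfold profileRatio
  field_simp
  ring

/-- The real part of `W / U`, where `W = U' - 2 κ ⟨U, U'⟩ U`, at index `t`. -/
def fluxRatio (κ A t : ℝ) : ℝ :=
  profileRatio κ A t * (t * ((1 - 2 * κ) * (1 + A * κ) / (κ + t ^ 2))) / 2

/-- Each term on the right is singular as `t → 0`. They cancel because `1 - 2κ + 2κη` is a multiple
of `t²`, which is why `fluxRatio` is written without division by `t`. -/
theorem fluxRatio_eq {c κ A t : ℝ} (hκ : 0 < κ) (hc : c ^ 2 = 2 - (1 - 2 * κ) * A) (ht : t ≠ 0) :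
    fluxRatio κ A t = profileRatio κ A t / (2 * t) - κ * profileValue κ A t / t := by
  have h1 := (one_sub_profileValue_pos hκ hc t).ne'
  have h2 := profileValue_denom (A := A) hκ t
  have h3 : t * ((1 - 2 * κ) * (1 + A * κ) / (κ + t ^ 2))
      = (1 - 2 * κ + 2 * κ * profileValue κ A t) / t := by
    rw [h2]
    field_simp
  unfold fluxRatio
  rw [h3]
  unfold profileRatio
  field_simp
  ring

/-- This is the real part of the flux equation divided by `U`, after inserting `U' / U = q / (2t) +
i c q / 2` with `q = η / (1 - η)`. -/
theorem hasDerivAt_fluxRatio_timeInv {c κ A x : ℝ} (hκ : 0 < κ) (hA : 0 ≤ A)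
    (hc : c ^ 2 = 2 - (1 - 2 * κ) * A) (hx : x ≠ 0) :
    HasDerivAt (fun x => fluxRatio κ A (timeInv κ A x))
      (-(profileRatio κ A (timeInv κ A x) ^ 2 / (4 * timeInv κ A x ^ 2)
        - c ^ 2 * profileRatio κ A (timeInv κ A x) ^ 2 / 4
        - c ^ 2 * profileRatio κ A (timeInv κ A x) / 2 + profileValue κ A (timeInv κ A x))) x := by
  have ht := timeInv_ne_zero hκ hA hx
  have hτ := hasDerivAt_timeInv hκ hA hx
  have hq := hasDerivAt_profileRatio_timeInv hκ hA hc hx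
  have h1 := one_sub_profileValue_pos hκ hc (timeInv κ A x)
  have h0 := one_sub_profileValue hκ hc (timeInv κ A x)
  have h2 : κ + timeInv κ A x ^ 2 ≠ 0 := by positivity
  have h5 : 1 + A * κ ≠ 0 := by positivity
  have hd := (hq.fun_mul (hτ.fun_mul (((hτ.fun_pow 2).const_add κ).fun_inv h2 |>.const_mul
    ((1 - 2 * κ) * (1 + A * κ))))).div_const 2
  have hd' : HasDerivAt (fun x => fluxRatio κ A (timeInv κ A x)) _ x := hd
  refine hd'.congr_deriv ?_
  have h4 : 1 + c ^ 2 * timeInv κ A x ^ 2 ≠ 0 := by positivity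
  have h3 : profileRatio κ A (timeInv κ A x)
      = (1 - 2 * κ) * (A * timeInv κ A x ^ 2 - 1) / (1 + c ^ 2 * timeInv κ A x ^ 2) := by
    unfold profileRatio
    rw [h0]
    unfold profileValue
    field_simp
  rw [h3]
  unfold profileValue
  clear hd hd' hq hτ h0 h1 h3
  generalize timeInv κ A x = t at *
  generalize c ^ 2 = C at *
  -- The denominator stays a single symbol while fractions are cleared; the relation between `c²`,
  -- `κ` and `A` is inserted only afterwards.
  obtain ⟨d, hd⟩ : ∃ d, d = 1 + C * t ^ 2 := ⟨_, rfl⟩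
  rw [← hd] at h4 ⊢
  field_simp
  rw [hd, hc]
  push_cast
  ring

theorem continuous_profileValue {κ A : ℝ} (hκ : 0 < κ) : Continuous (profileValue κ A) :=
  continuous_iff_continuousAt.2 fun t => (hasDerivAt_profileValue hκ t).continuousAt

theorem continuous_profileRatio {c κ A : ℝ} (hκ : 0 < κ) (hc : c ^ 2 = 2 - (1 - 2 * κ) * A) :
    Continuous (profileRatio κ A) :=
  (continuous_profileValue hκ).div (continuous_const.sub (continuous_profileValue hκ))
    fun t => (one_sub_profileValue_pos hκ hc t).ne'

theorem continuous_fluxRatio {c κ A : ℝ} (hκ : 0 < κ) (hc : c ^ 2 = 2 - (1 - 2 * κ) * A) :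
    Continuous (fluxRatio κ A) := by
  unfold fluxRatio
  have h : ∀ t : ℝ, κ + t ^ 2 ≠ 0 := fun t => by positivity
  exact ((continuous_profileRatio hκ hc).mul (continuous_id.mul
    (continuous_const.div (by fun_prop) h))).div_const 2

/-- The derivative of the cuspon away from the origin. -/
def cusponDeriv (c κ A x : ℝ) : ℂ :=
  ((profileRatio κ A (timeInv κ A x) / (2 * timeInv κ A x) : ℝ)
    + Complex.I * (c * profileRatio κ A (timeInv κ A x) / 2 : ℝ)) * cuspon c κ x

/-- The continuous representative of `U' - 2 κ ⟨U, U'⟩ U` for the cuspon `U`. -/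
def cusponFlux (c κ A x : ℝ) : ℂ :=
  ((fluxRatio κ A (timeInv κ A x) : ℝ)
    + Complex.I * (c * profileRatio κ A (timeInv κ A x) / 2 : ℝ)) * cuspon c κ x

section

variable {c κ A : ℝ} (hκ : 0 < κ) (hb : 1 - 2 * κ ≠ 0) (hA : 0 ≤ A) (hc0 : 0 ≤ c)
  (hc : c ^ 2 = 2 - (1 - 2 * κ) * A)

include hκ hb hA hc0 hc

theorem cuspProfile_eq_comp :
    cuspProfile c κ = fun x => profileValue κ A (timeInv κ A x) :=
  funext (cuspProfile_eq hκ hb hA hc0 hc)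

theorem continuous_cuspProfile : Continuous (cuspProfile c κ) := by
  rw [cuspProfile_eq_comp hκ hb hA hc0 hc]
  exact (continuous_profileValue hκ).comp (continuous_timeInv hκ hA)

theorem one_sub_cuspProfile_pos (x : ℝ) : 0 < 1 - cuspProfile c κ x := by
  rw [cuspProfile_eq hκ hb hA hc0 hc]
  exact one_sub_profileValue_pos hκ hc _

theorem hasDerivAt_cuspPhase (x : ℝ) :
    HasDerivAt (cuspPhase c κ) (c / 2 * profileRatio κ A (timeInv κ A x)) x := by
  have h : Continuous fun y => cuspProfile c κ y / (1 - cuspProfile c κ y) :=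
    (continuous_cuspProfile hκ hb hA hc0 hc).div
      (continuous_const.sub (continuous_cuspProfile hκ hb hA hc0 hc))
      fun x => (one_sub_cuspProfile_pos hκ hb hA hc0 hc x).ne'
  have h1 := ((h.integral_hasStrictDerivAt 0 x).hasDerivAt).const_mul (c / 2)
  rw [cuspProfile_eq hκ hb hA hc0 hc x] at h1
  exact h1

theorem continuous_cuspon : Continuous (cuspon c κ) := by
  have h1 : Continuous (cuspPhase c κ) := continuous_iff_continuousAt.2
    fun x => (hasDerivAt_cuspPhase hκ hb hA hc0 hc x).continuousAt
  have h2 := continuous_cuspProfile hκ hb hA hc0 hc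
  unfold cuspon
  fun_prop

theorem norm_sq_cuspon (x : ℝ) : ‖cuspon c κ x‖ ^ 2 = 1 - cuspProfile c κ x := by
  unfold cuspon
  rw [norm_mul, mul_comm Complex.I, Complex.norm_exp_ofReal_mul_I, mul_one, Complex.norm_real,
    Real.norm_eq_abs, sq_abs, Real.sq_sqrt (one_sub_cuspProfile_pos hκ hb hA hc0 hc x).le]

theorem cuspon_ne_zero (x : ℝ) : cuspon c κ x ≠ 0 := by
  intro h
  have := norm_sq_cuspon hκ hb hA hc0 hc x
  have h2 := one_sub_cuspProfile_pos hκ hb hA hc0 hc x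
  rw [h] at this
  simp at this
  linarith

theorem hasDerivAt_cuspProfile {x : ℝ} (hx : x ≠ 0) :
    HasDerivAt (cuspProfile c κ) (-(cuspProfile c κ x / timeInv κ A x)) x := by
  rw [cuspProfile_eq_comp hκ hb hA hc0 hc]
  exact hasDerivAt_profileValue_timeInv hκ hA hx

theorem hasDerivAt_cuspon {x : ℝ} (hx : x ≠ 0) :
    HasDerivAt (cuspon c κ) (cusponDeriv c κ A x) x := by
  have ht := timeInv_ne_zero hκ hA hx
  have h0 := one_sub_cuspProfile_pos hκ hb hA hc0 hc x
  have h1 := (((hasDerivAt_cuspProfile hκ hb hA hc0 hc hx).const_sub 1).sqrt h0.ne').ofReal_comp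
  have h2 := ((hasDerivAt_cuspPhase hκ hb hA hc0 hc x).ofReal_comp.const_mul Complex.I).cexp
  refine (h1.mul h2).congr_deriv ?_
  have hs : √(1 - cuspProfile c κ x) ≠ 0 := (Real.sqrt_pos.2 h0).ne'
  have e : profileRatio κ A (timeInv κ A x) / (2 * timeInv κ A x) * √(1 - cuspProfile c κ x)
      = - -(cuspProfile c κ x / timeInv κ A x) / (2 * √(1 - cuspProfile c κ x)) := by
    unfold profileRatio
    rw [← cuspProfile_eq hκ hb hA hc0 hc x]
    have := h0.ne'
    field_simp
    rw [Real.sq_sqrt h0.le]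
  rw [← e]
  unfold cusponDeriv cuspon
  push_cast
  ring

/-- At `x = 0` the index vanishes and both sides are `0` by the convention for division by zero. -/
theorem inner_cuspon_cusponDeriv (x : ℝ) :
    2 * inner ℝ (cuspon c κ x) (cusponDeriv c κ A x)
      = profileValue κ A (timeInv κ A x) / timeInv κ A x := by
  have h1 := norm_sq_cuspon hκ hb hA hc0 hc x
  have h2 := one_sub_profileValue_pos hκ hc (timeInv κ A x)
  rw [cuspProfile_eq hκ hb hA hc0 hc] at h1
  have h3 : inner ℝ (cuspon c κ x) (cusponDeriv c κ A x)
      = profileRatio κ A (timeInv κ A x) / (2 * timeInv κ A x) * ‖cuspon c κ x‖ ^ 2 := by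
    rw [Complex.sq_norm, Complex.normSq_apply, Complex.inner]
    unfold cusponDeriv
    simp [-Complex.ofReal_div, -Complex.ofReal_mul]
    ring
  rw [h3, h1]
  unfold profileRatio
  field_simp

theorem cusponFlux_eq {x : ℝ} (hx : x ≠ 0) :
    cusponFlux c κ A x = cusponDeriv c κ A x
      - ((2 * κ * inner ℝ (cuspon c κ x) (cusponDeriv c κ A x) : ℝ) : ℂ) * cuspon c κ x := by
  have h := inner_cuspon_cusponDeriv hκ hb hA hc0 hc x
  rw [show 2 * κ * inner ℝ (cuspon c κ x) (cusponDeriv c κ A x)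
    = κ * (2 * inner ℝ (cuspon c κ x) (cusponDeriv c κ A x)) by ring, h]
  unfold cusponFlux
  rw [fluxRatio_eq hκ hc (timeInv_ne_zero hκ hA hx)]
  unfold cusponDeriv
  push_cast
  ring

/-- The product rule for `W = (W / U) U`: the real part of `W / U` is governed by
`hasDerivAt_fluxRatio_timeInv`, the imaginary part by `hasDerivAt_profileRatio_timeInv`. -/
theorem hasDerivAt_cusponFlux {x : ℝ} (hx : x ≠ 0) :
    HasDerivAt (cusponFlux c κ A) (-(Complex.I * c * cusponDeriv c κ A x
      + cuspon c κ x * ((1 - ‖cuspon c κ x‖ ^ 2 : ℝ) : ℂ)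
      + ((2 * κ * inner ℝ (cuspon c κ x) (cusponDeriv c κ A x) : ℝ) : ℂ)
        * cusponDeriv c κ A x)) x := by
  have ht := timeInv_ne_zero hκ hA hx
  have h := inner_cuspon_cusponDeriv hκ hb hA hc0 hc x
  have h1 := (hasDerivAt_fluxRatio_timeInv hκ hA hc hx).ofReal_comp
  have h2 := (((hasDerivAt_profileRatio_timeInv hκ hA hc hx).const_mul c).div_const 2).ofReal_comp
  have h3 := (h1.add (h2.const_mul Complex.I)).mul (hasDerivAt_cuspon hκ hb hA hc0 hc hx)
  refine h3.congr_deriv ?_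
  rw [show 2 * κ * inner ℝ (cuspon c κ x) (cusponDeriv c κ A x)
    = κ * (2 * inner ℝ (cuspon c κ x) (cusponDeriv c κ A x)) by ring, h,
    norm_sq_cuspon hκ hb hA hc0 hc x, cuspProfile_eq hκ hb hA hc0 hc x]
  unfold cusponDeriv
  simp only [Pi.add_apply]
  rw [fluxRatio_eq hκ hc ht]
  have ht' : (timeInv κ A x : ℂ) ≠ 0 := by exact_mod_cast ht
  push_cast
  field_simp
  ring_nf
  simp only [Complex.I_sq]
  ring

theorem continuous_cusponFlux : Continuous (cusponFlux c κ A) := by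
  have h1 := (continuous_fluxRatio hκ hc).comp (continuous_timeInv hκ hA)
  have h2 := (continuous_profileRatio hκ hc).comp (continuous_timeInv hκ hA)
  have h3 := continuous_cuspon hκ hb hA hc0 hc
  unfold cusponFlux
  simp only [Function.comp_def] at h1 h2
  fun_prop

theorem measurable_cusponDeriv : Measurable (cusponDeriv c κ A) := by
  have h1 := (continuous_timeInv hκ hA).measurable
  have h2 := ((continuous_profileRatio hκ hc).comp (continuous_timeInv hκ hA)).measurable
  have h3 := (continuous_cuspon hκ hb hA hc0 hc).measurable
  unfold cusponDeriv
  simp only [Function.comp_def] at h2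
  fun_prop

/-- The density is computed exactly; then one factor `1 - A t²` is bounded by `1` and `κ + t²` from
below by `κ`, leaving a multiple of an integrable weight. -/
theorem norm_sq_cusponDeriv_le {x : ℝ} (hx : x ≠ 0) :
    ‖cusponDeriv c κ A x‖ ^ 2 ≤ (1 - 2 * κ) ^ 2 / (8 * κ) *
      ((1 - A * timeInv κ A x ^ 2) / timeInv κ A x ^ 2) := by
  have ht := timeInv_ne_zero hκ hA hx
  have h0 := one_sub_profileValue hκ hc (timeInv κ A x)
  have h1 : 0 < 1 - A * timeInv κ A x ^ 2 := by
    have : A * timeInv κ A x ^ 2 < 1 := timeInv_mem hκ hA x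
    linarith
  have h2 : ‖cusponDeriv c κ A x‖ ^ 2 = ((profileRatio κ A (timeInv κ A x) /
      (2 * timeInv κ A x)) ^ 2 + (c * profileRatio κ A (timeInv κ A x) / 2) ^ 2)
      * ‖cuspon c κ x‖ ^ 2 := by
    unfold cusponDeriv
    rw [norm_mul, mul_pow, mul_comm Complex.I, Complex.sq_norm (_ + _), Complex.normSq_add_mul_I]
  rw [h2, norm_sq_cuspon hκ hb hA hc0 hc, cuspProfile_eq hκ hb hA hc0 hc]
  have h3 : profileRatio κ A (timeInv κ A x)
      = (1 - 2 * κ) * (A * timeInv κ A x ^ 2 - 1) / (1 + c ^ 2 * timeInv κ A x ^ 2) := by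
    unfold profileRatio
    rw [h0]
    unfold profileValue
    have : 1 + c ^ 2 * timeInv κ A x ^ 2 ≠ 0 := by positivity
    have : κ + timeInv κ A x ^ 2 ≠ 0 := by positivity
    field_simp
  rw [h3, h0]
  generalize timeInv κ A x = t at *
  have e : (((1 - 2 * κ) * (A * t ^ 2 - 1) / (1 + c ^ 2 * t ^ 2) / (2 * t)) ^ 2
      + (c * ((1 - 2 * κ) * (A * t ^ 2 - 1) / (1 + c ^ 2 * t ^ 2)) / 2) ^ 2)
      * ((1 + c ^ 2 * t ^ 2) / (2 * (κ + t ^ 2)))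
      = (1 - 2 * κ) ^ 2 / (8 * (κ + t ^ 2)) * ((1 - A * t ^ 2) / t ^ 2) * (1 - A * t ^ 2) := by
    have : 1 + c ^ 2 * t ^ 2 ≠ 0 := by positivity
    have : κ + t ^ 2 ≠ 0 := by positivity
    field_simp
    ring
  rw [e]
  have h4 : 1 - A * t ^ 2 ≤ 1 := by nlinarith [mul_nonneg hA (sq_nonneg t)]
  calc _ ≤ (1 - 2 * κ) ^ 2 / (8 * (κ + t ^ 2)) * ((1 - A * t ^ 2) / t ^ 2) * 1 := by gcongr
    _ ≤ _ := by
      rw [mul_one]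
      gcongr
      nlinarith [sq_nonneg t]

theorem sq_cuspProfile_le {x : ℝ} (hx : x ≠ 0) :
    cuspProfile c κ x ^ 2 ≤ (1 - 2 * κ) ^ 2 / (4 * κ) *
      ((1 - A * timeInv κ A x ^ 2) / timeInv κ A x ^ 2) := by
  have ht := timeInv_ne_zero hκ hA hx
  have h1 : 0 < 1 - A * timeInv κ A x ^ 2 := by
    have : A * timeInv κ A x ^ 2 < 1 := timeInv_mem hκ hA x
    linarith
  rw [cuspProfile_eq hκ hb hA hc0 hc]
  unfold profileValue
  generalize timeInv κ A x = t at *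
  have h4 : 1 - A * t ^ 2 ≤ 1 := by nlinarith [mul_nonneg hA (sq_nonneg t)]
  have e : ((1 - 2 * κ) * (A * t ^ 2 - 1) / (2 * (κ + t ^ 2))) ^ 2
      = (1 - 2 * κ) ^ 2 * (1 - A * t ^ 2) * (1 - A * t ^ 2) / (4 * (κ + t ^ 2) ^ 2) := by
    field_simp
    ring
  have e2 : (1 - 2 * κ) ^ 2 / (4 * κ) * ((1 - A * t ^ 2) / t ^ 2)
      = (1 - 2 * κ) ^ 2 * (1 - A * t ^ 2) * 1 / (4 * (κ * t ^ 2)) := by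
    field_simp
  rw [e, e2]
  gcongr
  nlinarith [sq_nonneg t, sq_nonneg κ, sq_nonneg (t ^ 2), mul_nonneg hκ.le (sq_nonneg t)]

-- On the right half-line the weight is, up to the factor `√κ / (2(1 + Aκ))`, the derivative of the
-- bounded increasing function `arctan (t / √κ)`; the left half-line follows by evenness.
omit hb hc0 hc in
theorem integrable_timeInv_weight :
    Integrable fun x => (1 - A * timeInv κ A x ^ 2) / timeInv κ A x ^ 2 := by
  have hpos : ∀ x, 0 < 1 - A * timeInv κ A x ^ 2 := fun x => by
    have : A * timeInv κ A x ^ 2 < 1 := timeInv_mem hκ hA x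
    linarith
  have hmono : Monotone fun x => Real.arctan (timeInv κ A x / √κ) := fun x y hxy =>
    Real.arctan_mono (div_le_div_of_nonneg_right ((strictMono_timeInv hκ hA).monotone hxy)
      (Real.sqrt_nonneg κ))
  have hbdd : BddAbove (Set.range fun x => Real.arctan (timeInv κ A x / √κ)) :=
    ⟨Real.pi / 2, by rintro _ ⟨x, rfl⟩; exact (Real.arctan_lt_pi_div_two _).le⟩
  have h1 : IntegrableOn (fun x => √κ / (2 * (1 + A * κ)) *
      ((1 - A * timeInv κ A x ^ 2) / timeInv κ A x ^ 2)) (Set.Ioi 0) := by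
    refine integrableOn_Ioi_deriv_of_nonneg (g := fun x => Real.arctan (timeInv κ A x / √κ))
      ?_ (fun x hx => ?_) (fun x hx => ?_) (tendsto_atTop_ciSup hmono hbdd)
    · exact (Real.continuous_arctan.comp
        ((continuous_timeInv hκ hA).div_const _)).continuousWithinAt
    · have hx0 : x ≠ 0 := ne_of_gt hx
      have ht := timeInv_ne_zero hκ hA hx0
      refine ((hasDerivAt_arctan_div_sqrt hκ _).comp x
        (hasDerivAt_timeInv hκ hA hx0)).congr_deriv ?_
      have : κ + timeInv κ A x ^ 2 ≠ 0 := by positivity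
      field_simp
    · have := hpos x
      positivity
  have h2 : IntegrableOn (fun x => (1 - A * timeInv κ A x ^ 2) / timeInv κ A x ^ 2)
      (Set.Ioi 0) := by
    refine IntegrableOn.congr_fun (h1.const_mul (√κ / (2 * (1 + A * κ)))⁻¹) (fun x _ => ?_)
      measurableSet_Ioi
    have : √κ / (2 * (1 + A * κ)) ≠ 0 := (div_pos (Real.sqrt_pos.2 hκ) (by positivity)).ne'
    rw [inv_mul_cancel_left₀ this]
  have h3 : IntegrableOn (fun x => (1 - A * timeInv κ A x ^ 2) / timeInv κ A x ^ 2)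
      (Set.Iic 0) := by
    rw [integrableOn_Iic_iff_integrableOn_Iio]
    have h4 := (Measure.measurePreserving_neg (volume : Measure ℝ)).integrableOn_comp_preimage
      (Homeomorph.neg ℝ).measurableEmbedding |>.2 h2
    have e : (Neg.neg : ℝ → ℝ) ⁻¹' Set.Ioi 0 = Set.Iio 0 := by ext; simp
    rw [e] at h4
    refine h4.congr_fun (fun x _ => ?_) measurableSet_Iio
    simp [timeInv_neg hκ hA]
  rw [← integrableOn_univ, ← Set.Iic_union_Ioi (a := (0 : ℝ))]
  exact h3.union h2

theorem memLp_cuspProfile : MemLp (cuspProfile c κ) 2 := by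
  have hm := (continuous_cuspProfile hκ hb hA hc0 hc).aestronglyMeasurable (μ := volume)
  rw [memLp_two_iff_integrable_sq hm]
  refine ((integrable_timeInv_weight hκ hA).const_mul ((1 - 2 * κ) ^ 2 / (4 * κ))).mono'
    (hm.pow 2) ?_
  filter_upwards [compl_mem_ae_iff.2 (measure_singleton (0 : ℝ))] with x hx
  rw [Real.norm_of_nonneg (sq_nonneg _)]
  exact sq_cuspProfile_le hκ hb hA hc0 hc hx

theorem memLp_cusponDeriv : MemLp (cusponDeriv c κ A) 2 := by
  have hm := (measurable_cusponDeriv hκ hb hA hc0 hc).aestronglyMeasurable (μ := volume)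
  rw [memLp_two_iff_integrable_sq_norm hm]
  refine ((integrable_timeInv_weight hκ hA).const_mul ((1 - 2 * κ) ^ 2 / (8 * κ))).mono'
    (hm.norm.pow 2) ?_
  filter_upwards [compl_mem_ae_iff.2 (measure_singleton (0 : ℝ))] with x hx
  rw [Real.norm_of_nonneg (sq_nonneg _)]
  exact norm_sq_cusponDeriv_le hκ hb hA hc0 hc hx

end

/-! ### The cuspon is a weak solution of finite energy -/

theorem aestronglyMeasurable_inner_mul {u v : ℝ → ℂ} (k : ℝ) (hu : Continuous u)
    (hv : AEStronglyMeasurable v volume) (w : ℝ → ℂ) (hw : AEStronglyMeasurable w volume) :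
    AEStronglyMeasurable (fun x => ((k * inner ℝ (u x) (v x) : ℝ) : ℂ) * w x) volume :=
  (Complex.continuous_ofReal.comp_aestronglyMeasurable
    ((hu.aestronglyMeasurable.inner hv).const_mul k)).mul hw

theorem locallyIntegrable_forcing {u v : ℝ → ℂ} (c κ : ℝ) (hu : Continuous u) (hv : MemLp v 2) :
    LocallyIntegrable (fun x => Complex.I * c * v x + u x * ((1 - ‖u x‖ ^ 2 : ℝ) : ℂ)
      + ((2 * κ * inner ℝ (u x) (v x) : ℝ) : ℂ) * v x) := by
  have h1 : LocallyIntegrable (fun x => Complex.I * c * v x) :=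
    (hv.locallyIntegrable (by norm_num)).smul (Complex.I * c)
  have h2 : LocallyIntegrable (fun x => u x * ((1 - ‖u x‖ ^ 2 : ℝ) : ℂ)) := by
    apply Continuous.locallyIntegrable
    fun_prop
  have h3 : LocallyIntegrable (fun x => ((2 * κ * inner ℝ (u x) (v x) : ℝ) : ℂ) * v x) := by
    refine locallyIntegrable_of_norm_le_mul (f := fun x => ‖v x‖ ^ 2)
      (k := fun x => |2 * κ| * ‖u x‖) (by fun_prop)
      ((memLp_two_iff_integrable_sq_norm hv.1).1 hv).locallyIntegrable
      (aestronglyMeasurable_inner_mul _ hu hv.1 _ hv.1) fun x => ?_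
    rw [norm_mul, Complex.norm_real, norm_mul, Real.norm_eq_abs (2 * κ),
      Real.norm_of_nonneg (sq_nonneg ‖v x‖)]
    calc |2 * κ| * ‖inner ℝ (u x) (v x)‖ * ‖v x‖ ≤ |2 * κ| * (‖u x‖ * ‖v x‖) * ‖v x‖ := by
          gcongr
          exact norm_inner_le_norm _ _
      _ = |2 * κ| * ‖u x‖ * ‖v x‖ ^ 2 := by ring
  exact (h1.add h2).add h3

theorem integrable_inner_of_hasCompactSupport {g φ : ℝ → ℂ} (hg : LocallyIntegrable g)
    (hφ : Continuous φ) (hs : HasCompactSupport φ) : Integrable fun x => inner ℝ (g x) (φ x) := by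
  have hi : Integrable fun x => ‖φ x‖ • g x :=
    hg.integrable_smul_left_of_hasCompactSupport hφ.norm hs.norm
  refine hi.norm.mono' (hg.aestronglyMeasurable.inner hφ.aestronglyMeasurable)
    (Filter.Eventually.of_forall fun x => ?_)
  rw [norm_smul, norm_norm, mul_comm]
  exact norm_inner_le_norm _ _

theorem isWeakDeriv_of_hasDerivAt_of_ne {u v : ℝ → ℂ} (a : ℝ) (hu : Continuous u)
    (hv : LocallyIntegrable v) (hd : ∀ x, x ≠ a → HasDerivAt u (v x) x) : IsWeakDeriv u v := by
  refine ⟨hu.locallyIntegrable, hv, fun φ hφ hs => ?_⟩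
  have hdc : Continuous (deriv φ) := hφ.continuous_deriv (by exact_mod_cast le_top)
  have e1 : Integrable fun x => ((deriv φ x : ℝ) : ℂ) * u x := by
    have := hu.locallyIntegrable (μ := volume) |>.integrable_smul_left_of_hasCompactSupport
      hdc hs.deriv
    simpa only [Complex.real_smul] using this
  have e2 : Integrable fun x => ((φ x : ℝ) : ℂ) * v x := by
    have := hv.integrable_smul_left_of_hasCompactSupport hφ.continuous hs
    simpa only [Complex.real_smul] using this
  have h := integral_eq_zero_of_hasDerivAt_of_ne a (f := fun x => ((φ x : ℝ) : ℂ) * u x)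
    (f' := fun x => ((deriv φ x : ℝ) : ℂ) * u x + ((φ x : ℝ) : ℂ) * v x)
    ((Complex.continuous_ofReal.comp hφ.continuous).mul hu)
    (HasCompactSupport.mul_right (hs.comp_left (g := Complex.ofReal) Complex.ofReal_zero))
    (fun x hx => ((hφ.differentiable (by simp) x).hasDerivAt.ofReal_comp.mul (hd x hx)))
    (e1.add e2)
  rw [integral_add e1 e2] at h
  exact eq_neg_of_add_eq_zero_left h

/-- Off `a`, the derivative of `⟨w, φ⟩` is minus the integrand of the weak equation. Continuity of
`w` at `a` is what excludes a point mass there. -/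
theorem isWeakSolution_of_hasDerivAt_of_ne {c κ : ℝ} {u v w : ℝ → ℂ} (a : ℝ) (hu : Continuous u)
    (hv : MemLp v 2) (hd : ∀ x, x ≠ a → HasDerivAt u (v x) x) (hw : Continuous w)
    (hwv : ∀ x, x ≠ a → w x = v x - ((2 * κ * inner ℝ (u x) (v x) : ℝ) : ℂ) * u x)
    (hwd : ∀ x, x ≠ a → HasDerivAt w (-(Complex.I * c * v x
      + u x * ((1 - ‖u x‖ ^ 2 : ℝ) : ℂ) + ((2 * κ * inner ℝ (u x) (v x) : ℝ) : ℂ) * v x)) x) :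
    IsWeakSolution c κ u := by
  refine ⟨v, isWeakDeriv_of_hasDerivAt_of_ne a hu (hv.locallyIntegrable (by norm_num)) hd,
    fun φ hφ hs => ?_⟩
  have hdc : Continuous (deriv φ) := hφ.continuous_deriv (by exact_mod_cast le_top)
  have hloc := locallyIntegrable_forcing c κ hu hv
  have e1 := integrable_inner_of_hasCompactSupport hloc.neg hφ.continuous hs
  have e2 := integrable_inner_of_hasCompactSupport (hw.locallyIntegrable (μ := volume)) hdc hs.deriv
  have h := integral_eq_zero_of_hasDerivAt_of_ne a (f := fun x => inner ℝ (w x) (φ x))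
    (hw.inner hφ.continuous) (hs.mono fun x hx => by
      contrapose! hx
      simp only [Function.notMem_support] at hx ⊢
      rw [hx, inner_zero_right])
    (fun x hx => (hwd x hx).inner ℝ (hφ.differentiable (by simp) x).hasDerivAt)
    (e2.add e1)
  rw [← neg_eq_zero, ← integral_neg] at h
  rw [← h]
  refine integral_congr_ae ?_
  filter_upwards [compl_mem_ae_iff.2 (measure_singleton a)] with x hx
  rw [hwv x hx]
  simp only [inner_neg_left, inner_add_left, inner_sub_left, Complex.inner]
  simp
  ring

theorem one_sub_profileValue_eq_iff {κ A : ℝ} (hκ : 0 < κ) (hb : 1 - 2 * κ ≠ 0)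
    (hA : 0 ≤ A) (t : ℝ) :
    1 - profileValue κ A t = 1 / (2 * κ) ↔ t = 0 := by
  have h := profileValue_denom (A := A) hκ t
  have h0 : (1 - 2 * κ) * (1 + A * κ) / (κ + t ^ 2) ≠ 0 :=
    div_ne_zero (mul_ne_zero hb (by positivity)) (by positivity)
  rw [eq_div_iff (by positivity)]
  constructor
  · intro h1
    have h2 : t ^ 2 * ((1 - 2 * κ) * (1 + A * κ) / (κ + t ^ 2)) = 0 := by
      rw [← h]
      linarith
    simpa [h0] using h2
  · rintro rfl
    rw [zero_pow two_ne_zero, zero_mul] at h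
    linarith

section

variable {c κ A : ℝ} (hκ : 0 < κ) (hb : 1 - 2 * κ ≠ 0) (hA : 0 ≤ A) (hc0 : 0 ≤ c)
  (hc : c ^ 2 = 2 - (1 - 2 * κ) * A)

include hκ hb hA hc0 hc

theorem memEnergySpace_cuspon : MemEnergySpace (cuspon c κ) := by
  refine ⟨continuous_cuspon hκ hb hA hc0 hc, ?_, cusponDeriv c κ A,
    isWeakDeriv_of_hasDerivAt_of_ne 0 (continuous_cuspon hκ hb hA hc0 hc)
      ((memLp_cusponDeriv hκ hb hA hc0 hc).locallyIntegrable (by norm_num))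
      fun x hx => hasDerivAt_cuspon hκ hb hA hc0 hc hx, memLp_cusponDeriv hκ hb hA hc0 hc⟩
  have e : (fun x => 1 - ‖cuspon c κ x‖ ^ 2) = cuspProfile c κ := by
    funext x
    rw [norm_sq_cuspon hκ hb hA hc0 hc]
    ring
  rw [e]
  exact memLp_cuspProfile hκ hb hA hc0 hc

theorem isWeakSolution_cuspon : IsWeakSolution c κ (cuspon c κ) :=
  isWeakSolution_of_hasDerivAt_of_ne 0 (continuous_cuspon hκ hb hA hc0 hc)
    (memLp_cusponDeriv hκ hb hA hc0 hc) (fun _ hx => hasDerivAt_cuspon hκ hb hA hc0 hc hx)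
    (continuous_cusponFlux hκ hb hA hc0 hc) (fun _ hx => cusponFlux_eq hκ hb hA hc0 hc hx)
    (fun _ hx => hasDerivAt_cusponFlux hκ hb hA hc0 hc hx)

theorem singularSet_cuspon : singularSet κ (cuspon c κ) = {0} := by
  ext x
  rw [singularSet, Set.mem_ofPred_eq, norm_sq_cuspon hκ hb hA hc0 hc,
    cuspProfile_eq hκ hb hA hc0 hc, one_sub_profileValue_eq_iff hκ hb hA, Set.mem_singleton_iff]
  refine ⟨fun h => ?_, fun h => by rw [h, timeInv_zero hκ hA]⟩
  by_contra hx
  exact timeInv_ne_zero hκ hA hx h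

theorem not_isTrivial_cuspon : ¬ IsTrivial (cuspon c κ) := by
  rintro ⟨φ, h⟩
  have h0 : (0 : ℝ) ∈ singularSet κ (cuspon c κ) := by
    rw [singularSet_cuspon hκ hb hA hc0 hc]
    rfl
  rw [singularSet, Set.mem_ofPred_eq, h, mul_comm Complex.I, Complex.norm_exp_ofReal_mul_I,
    eq_div_iff (by positivity)] at h0
  exact hb (by linarith)

end

/-! ### The profile equation on a half-line -/

theorem pos_of_ne_zero_of_pos {s : Set ℝ} (hs : IsPreconnected s) {f : ℝ → ℝ}
    (hf : ContinuousOn f s) (h0 : ∀ x ∈ s, f x ≠ 0) {a : ℝ} (ha : a ∈ s) (hpos : 0 < f a) :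
    ∀ x ∈ s, 0 < f x := by
  intro x hx
  by_contra h
  obtain ⟨y, hy, hy0⟩ := hs.intermediate_value hx ha hf ⟨not_lt.1 h, hpos.le⟩
  exact h0 y hy hy0

theorem eq_zero_of_abs_deriv_le_left {f f' : ℝ → ℝ} {K a b : ℝ}
    (hd : ∀ x ∈ Set.Icc a b, HasDerivAt f (f' x) x) (hb : f b = 0)
    (hK : ∀ x ∈ Set.Icc a b, |f' x| ≤ K * |f x|) : ∀ x ∈ Set.Icc a b, f x = 0 := by
  have key := eq_zero_of_abs_deriv_le_mul_abs_self_of_eq_zero_right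
    (f := fun x => f (-x)) (f' := fun x => -f' (-x)) (K := K) (a := -b) (b := -a)
    (fun x hx => by
      have hx' : -x ∈ Set.Icc a b := ⟨by linarith [hx.2], by linarith [hx.1]⟩
      exact ((hd (-x) hx').continuousAt.comp continuous_neg.continuousAt).continuousWithinAt)
    (fun x hx => by
      have hx' : -x ∈ Set.Icc a b := ⟨by linarith [hx.2], by linarith [hx.1]⟩
      have := (hd (-x) hx').comp x (hasDerivAt_neg x)
      rw [mul_neg_one] at this
      exact this.hasDerivWithinAt)
    (by simpa using hb)
    (fun x hx => by
      have hx' : -x ∈ Set.Icc a b := ⟨by linarith [hx.2], by linarith [hx.1]⟩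
      simpa using hK (-x) hx')
  intro x hx
  have := key (-x) ⟨by linarith [hx.2], by linarith [hx.1]⟩
  simpa using this

/-- Along the solution the function `travelTime κ A (t x)` has slope one and vanishes at `0`, so it
equals `x`. Most of the proof extracts a sign from an equation that only knows `e²`. -/
theorem eq_profileValue_timeInv {κ A : ℝ} (hκ : 0 < κ) (hA : 0 ≤ A)
    {η e : ℝ → ℝ} (hη : Continuous η) (he : ContinuousOn e (Set.Ioi 0))
    (hd : ∀ x, 0 < x → HasDerivAt η (e x) x)
    (hode : ∀ x, 0 < x → e x ^ 2 * (1 - 2 * κ + 2 * κ * η x)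
      = η x ^ 2 * ((1 - 2 * κ) * A - 2 * η x))
    (hb : 1 - 2 * κ ≠ 0) (h0 : 1 - 2 * κ + 2 * κ * η 0 = 0)
    (hne : ∀ x, 0 < x → 1 - 2 * κ + 2 * κ * η x ≠ 0)
    (hsmall : ∀ ε > 0, ∃ x, 0 < x ∧ |η x| < ε) :
    ∀ x, 0 < x → η x = profileValue κ A (timeInv κ A x) := by
  obtain ⟨b, hbdef⟩ : ∃ b, b = 1 - 2 * κ := ⟨_, rfl⟩
  rw [← hbdef] at hb h0
  simp only [← hbdef] at hode hne
  have hη0 : η 0 ≠ 0 := by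
    intro h
    rw [h] at h0
    exact hb (by linarith)
  have hb2 : 0 < b ^ 2 := by positivity
  -- the coefficient of the squared derivative keeps the sign of `b`
  have hD : ∀ x, 0 < x → 0 < b * (b + 2 * κ * η x) := by
    -- If `|η| < |b| / (2κ)` then `|2κη| < |b|`, so `b + 2κη` has the sign of `b`; since it has no
    -- zero, it keeps that sign on the half-line.
    obtain ⟨x₁, hx₁, hs⟩ := hsmall (|b| / (2 * κ)) (by positivity)
    refine pos_of_ne_zero_of_pos isPreconnected_Ioi (f := fun x => b * (b + 2 * κ * η x))
      (by fun_prop) (fun x hx => mul_ne_zero hb (hne x hx)) (a := x₁) hx₁ ?_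
    rw [lt_div_iff₀ (by positivity)] at hs
    have h1 : |b| * (|η x₁| * (2 * κ)) < |b| * |b| :=
      mul_lt_mul_of_pos_left hs (abs_pos.2 hb)
    have h2 : -(b * η x₁) ≤ |b| * |η x₁| := by
      rw [← abs_mul]
      exact neg_le_abs _
    rw [abs_mul_abs_self] at h1
    nlinarith
  -- the profile does not vanish
  have hη_ne : ∀ x ∈ Set.Ici (0 : ℝ), η x ≠ 0 := by
    intro x₁ hx₁ hz
    rcases (Set.mem_Ici.1 hx₁).eq_or_lt with h | h
    · exact hη0 (by rwa [← h] at hz)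
    -- A zero propagates to the left by Grönwall: with `K` bounding the quotient on `[δ, x₁]`, the
    -- equation gives `|e| ≤ √K |η|`. The interval avoids `0`, where the denominator vanishes.
    have hzero : ∀ δ ∈ Set.Ioo 0 x₁, η δ = 0 := by
      intro δ hδ
      have hpos : ∀ x ∈ Set.Icc δ x₁, 0 < x := fun x hx => hδ.1.trans_le hx.1
      have hcont : ContinuousOn (fun x => (b * A - 2 * η x) / (b + 2 * κ * η x))
          (Set.Icc δ x₁) :=
        ContinuousOn.div (by fun_prop) (by fun_prop) fun x hx => hne x (hpos x hx)
      obtain ⟨K, hK⟩ := isCompact_Icc.exists_bound_of_continuousOn hcont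
      refine eq_zero_of_abs_deriv_le_left (f' := e) (K := √K) (fun x hx => hd x (hpos x hx)) hz
        (fun x hx => ?_) δ ⟨le_rfl, hδ.2.le⟩
      have hK0 : 0 ≤ K := (norm_nonneg _).trans (hK x hx)
      rw [← Real.sqrt_sq_eq_abs, ← Real.sqrt_sq_eq_abs, ← Real.sqrt_mul hK0]
      refine Real.sqrt_le_sqrt ?_
      have h1 : e x ^ 2 = (b * A - 2 * η x) / (b + 2 * κ * η x) * η x ^ 2 := by
        have := hne x (hpos x hx)
        have h2 := hode x (hpos x hx)
        rw [div_mul_eq_mul_div, eq_div_iff this, h2]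
        ring
      rw [h1]
      have h3 := (le_abs_self _).trans (hK x hx)
      gcongr
    have hlim : Filter.Tendsto η (𝓝[>] 0) (𝓝 0) := by
      refine tendsto_const_nhds.congr' ?_
      filter_upwards [Ioo_mem_nhdsGT h] with δ hδ
      exact (hzero δ hδ).symm
    exact hη0 (tendsto_nhds_unique (hη.continuousWithinAt (s := Set.Ioi 0) (x := 0)).tendsto hlim)
  have hbη : ∀ x ∈ Set.Ici (0 : ℝ), b * η x < 0 := by
    intro x hx
    have := pos_of_ne_zero_of_pos isPreconnected_Ici (f := fun x => -(b * η x))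
      (by fun_prop) (fun x hx => neg_ne_zero.2 (mul_ne_zero hb (hη_ne x hx))) (a := 0)
      (Set.mem_Ici.2 le_rfl) (by
        have : 0 < -(b * η 0) * (2 * κ) := by nlinarith
        exact pos_of_mul_pos_left this (by positivity)) x hx
    linarith
  have hbr : ∀ x ∈ Set.Ici (0 : ℝ), 0 < b * (b * A - 2 * η x) := by
    intro x hx
    have := hbη x hx
    nlinarith [mul_nonneg hb2.le hA]
  have hr : ∀ x ∈ Set.Ici (0 : ℝ), b * A - 2 * η x ≠ 0 := fun x hx =>
    right_ne_zero_of_mul (hbr x hx).ne'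
  -- the travel-time index
  obtain ⟨q, hq⟩ : ∃ q : ℝ → ℝ, q = fun x => (b + 2 * κ * η x) / (b * A - 2 * η x) := ⟨_, rfl⟩
  obtain ⟨t, ht⟩ : ∃ t : ℝ → ℝ, t = fun x => √(q x) := ⟨_, rfl⟩
  have hq0 : q 0 = 0 := by
    rw [hq]
    simp only [h0, zero_div]
  have hqpos : ∀ x, 0 < x → 0 < q x := by
    intro x hx
    rw [hq]
    simp only
    rw [← mul_div_mul_left _ _ hb]
    exact div_pos (hD x hx) (hbr x hx.le)
  have ht0 : t 0 = 0 := by rw [ht]; simp only [hq0, Real.sqrt_zero]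
  have htpos : ∀ x, 0 < x → 0 < t x := fun x hx => by
    rw [ht]
    exact Real.sqrt_pos.2 (hqpos x hx)
  have htsq : ∀ x ∈ Set.Ici (0 : ℝ), t x ^ 2 = q x := by
    intro x hx
    rw [ht]
    refine Real.sq_sqrt ?_
    rcases (Set.mem_Ici.1 hx).eq_or_lt with h | h
    · rw [← h, hq0]
    · exact (hqpos x h).le
  have htS : ∀ x ∈ Set.Ici (0 : ℝ), t x ∈ timeDomain A ∧ profileValue κ A (t x) = η x := by
    intro x hx
    refine profileValue_of_sq hκ hA ?_ ?_
    · rw [← hbdef]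
      exact hbη x hx
    · rw [← hbdef, htsq x hx, hq]
  have hqc : ContinuousOn q (Set.Ici 0) := by
    rw [hq]
    exact ContinuousOn.div (by fun_prop) (by fun_prop) hr
  have htc : ContinuousOn t (Set.Ici 0) := by
    rw [ht]
    exact hqc.sqrt
  -- the sign of the derivative
  have het2 : ∀ x, 0 < x → (e x * t x) ^ 2 = η x ^ 2 := by
    intro x hx
    have h1 := hr x hx.le
    rw [mul_pow, htsq x hx.le, hq]
    simp only
    rw [← mul_div_assoc, hode x hx, mul_div_assoc, div_self h1, mul_one]
  -- Here `e t = ±η`, with one sign on the whole half-line. The plus sign would make `η²`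
  -- increasing, against the smallness of `η` at some point.
  have hsign : ∀ x, 0 < x → e x * t x * η x < 0 := by
    have hne' : ∀ x ∈ Set.Ioi (0 : ℝ), e x * t x * η x ≠ 0 := by
      intro x hx h
      have h1 := het2 x hx
      have h2 := hη_ne x (Set.mem_Ici.2 (le_of_lt hx))
      rcases mul_eq_zero.1 h with h | h
      · rw [h] at h1
        exact h2 (by simpa using h1.symm)
      · exact h2 h
    have hcont : ContinuousOn (fun x => e x * t x * η x) (Set.Ioi 0) :=
      (he.mul (htc.mono Set.Ioi_subset_Ici_self)).mul hη.continuousOn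
    intro x hx
    by_contra h
    have hall := pos_of_ne_zero_of_pos isPreconnected_Ioi hcont hne' hx
      (lt_of_le_of_ne (not_lt.1 h) (hne' x hx).symm)
    obtain ⟨x₁, hx₁, hs⟩ := hsmall |η 0| (abs_pos.2 hη0)
    have hmono : StrictMonoOn (fun x => η x ^ 2) (Set.Ici 0) := by
      refine strictMonoOn_of_deriv_pos (convex_Ici 0) (by fun_prop) fun y hy => ?_
      rw [interior_Ici] at hy
      rw [((hd y hy).fun_pow 2).deriv]
      have h1 := hall y hy
      have h2 : 0 < e y * η y := by
        refine pos_of_mul_pos_left (b := t y) ?_ (htpos y hy).le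
        linarith
      push_cast
      nlinarith
    have := hmono (Set.mem_Ici.2 le_rfl) (Set.mem_Ici.2 hx₁.le) hx₁
    exact absurd (sq_lt_sq.1 this) (not_lt.2 hs.le)
  have het : ∀ x, 0 < x → e x = -η x / t x := by
    intro x hx
    rw [eq_div_iff (htpos x hx).ne']
    rcases sq_eq_sq_iff_eq_or_eq_neg.1 (het2 x hx) with h | h
    · have := hsign x hx
      rw [h] at this
      nlinarith [sq_nonneg (η x)]
    · exact h
  -- the travel time along the profile has slope one
  have hder : ∀ x, 0 < x → HasDerivAt (fun x => travelTime κ A (t x)) 1 x := by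
    intro x hx
    have hx' : x ∈ Set.Ici (0 : ℝ) := hx.le
    have htx := htpos x hx
    have hmem := (htS x hx').1
    have h1 : 1 - A * t x ^ 2 ≠ 0 := by
      have : A * t x ^ 2 < 1 := hmem
      linarith
    have hqd : HasDerivAt q _ x :=
      hq ▸ (((hd x hx).const_mul (2 * κ)).const_add b).fun_div
        (((hd x hx).const_mul 2).const_sub (b * A)) (hr x hx')
    have htd : HasDerivAt t _ x := ht ▸ hqd.sqrt (hqpos x hx).ne'
    refine ((hasDerivAt_travelTime hκ hA hmem).comp x htd).congr_deriv ?_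
    have e1 : √(q x) = t x := by rw [ht]
    have e2 := profileValue_numer (A := A) hκ (t x)
    have e3 := profileValue_denom (A := A) hκ (t x)
    have e4 : η x = b * (A * t x ^ 2 - 1) / (2 * (κ + t x ^ 2)) := by
      rw [← (htS x hx').2, hbdef]
      rfl
    rw [(htS x hx').2, ← hbdef] at e2 e3
    rw [e1, e2, e3, het x hx, e4]
    have h2 : κ + t x ^ 2 ≠ 0 := by positivity
    have h3 : 1 + A * κ ≠ 0 := by positivity
    obtain ⟨d, hd⟩ : ∃ d, d = 1 - A * t x ^ 2 := ⟨_, rfl⟩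
    rw [show A * t x ^ 2 - 1 = -d by rw [hd]; ring]
    rw [← hd] at h1 ⊢
    field_simp
    ring
  intro x hx
  have hc1 : ContinuousOn (fun x => travelTime κ A (t x)) (Set.Icc 0 x) := fun y hy =>
    ((hasDerivAt_travelTime hκ hA (htS y hy.1).1).continuousAt.comp_continuousWithinAt
      ((htc y hy.1).mono Set.Icc_subset_Ici_self))
  obtain ⟨y, hy, h⟩ := exists_hasDerivAt_eq_slope (fun x => travelTime κ A (t x)) (fun _ => 1) hx hc1
    (fun y hy => hder y hy.1)
  rw [ht0, travelTime_zero hA, eq_div_iff (by linarith)] at h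
  have h2 : travelTime κ A (t x) = x := by linarith
  rw [← (htS x hx.le).2, ← h2, timeInv_travelTime hκ hA (htS x hx.le).1, h2]

/-! ### First integrals on a half-line -/

/-- This takes the place of limits at infinity: a quantity known to be constant need only be small
at suitable points. -/
theorem exists_pos_lt_of_integrableOn_Ioi {f : ℝ → ℝ} (hf : IntegrableOn f (Set.Ioi 0)) {ε : ℝ}
    (hε : 0 < ε) : ∃ x, 0 < x ∧ f x < ε := by
  by_contra! h
  have h1 : IntegrableOn (fun _ : ℝ => ε) (Set.Ioi 0) := by
    refine Integrable.mono' hf aestronglyMeasurable_const ?_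
    filter_upwards [ae_restrict_mem measurableSet_Ioi] with x hx
    rw [Real.norm_of_nonneg hε.le]
    exact h x hx
  rw [integrableOn_const_iff] at h1
  simp [hε.ne'] at h1

theorem eq_of_hasDerivAt_zero_Ioi {E : Type*} [NormedAddCommGroup E] [NormedSpace ℝ E]
    {f : ℝ → E} (hf : ∀ x, 0 < x → HasDerivAt f 0 x) {x y : ℝ}
    (hx : 0 < x) (hy : 0 < y) : f x = f y :=
  isOpen_Ioi.is_const_of_deriv_eq_zero (𝕜 := ℝ) isPreconnected_Ioi
    (fun z hz => (hf z hz).differentiableAt.differentiableWithinAt) (fun z hz => (hf z hz).deriv)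
    (Set.mem_Ioi.2 hx) (Set.mem_Ioi.2 hy)

theorem normSq_mul_normSq_eq (u v : ℂ) :
    ‖u‖ ^ 2 * ‖v‖ ^ 2 = inner ℝ u v ^ 2 + inner ℝ (Complex.I * u) v ^ 2 := by
  simp only [Complex.sq_norm, Complex.normSq_apply, Complex.inner]
  simp
  ring

/-- Momentum first integral: pairing the equation with `iu` removes the `κ` term and the potential,
since `⟨iu, u⟩ = 0`. Finite energy forces the constant to be zero. -/
theorem inner_I_mul_eq_of_ode {c κ : ℝ} {u v v' : ℝ → ℂ}
    (hd : ∀ x, 0 < x → HasDerivAt u (v x) x) (hd2 : ∀ x, 0 < x → HasDerivAt v (v' x) x)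
    (heq : ∀ x, 0 < x → v' x - ((2 * κ * (‖v x‖ ^ 2 + inner ℝ (u x) (v' x)) : ℝ) : ℂ) * u x
      = -(Complex.I * c * v x + u x * ((1 - ‖u x‖ ^ 2 : ℝ) : ℂ)))
    (hint : IntegrableOn (fun x => (1 - ‖u x‖ ^ 2) ^ 2 + ‖v x‖ ^ 2) (Set.Ioi 0)) {x : ℝ}
    (hx : 0 < x) : inner ℝ (Complex.I * u x) (v x) = c / 2 * (1 - ‖u x‖ ^ 2) := by
  obtain ⟨P, hP⟩ : ∃ P : ℝ → ℝ,
      P = fun x => inner ℝ (Complex.I * u x) (v x) - c / 2 * (1 - ‖u x‖ ^ 2) := ⟨_, rfl⟩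
  have hPd : ∀ x, 0 < x → HasDerivAt P 0 x := by
    intro x hx
    have h1 := (((hd x hx).const_mul Complex.I).inner ℝ (hd2 x hx)).sub
      (((hd x hx).norm_sq.const_sub 1).const_mul (c / 2))
    rw [hP]
    refine h1.congr_deriv ?_
    have e1 := congrArg Complex.re (heq x hx)
    have e2 := congrArg Complex.im (heq x hx)
    simp [-Complex.ofReal_mul, -Complex.ofReal_add, -Complex.ofReal_sub, -Complex.ofReal_pow]
      at e1 e2
    simp only [Complex.inner]
    simp
    linear_combination (u x).re * e2 - (u x).im * e1
  have hz : P x = 0 := by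
    by_contra hne
    have hpos : 0 < P x ^ 2 := by positivity
    -- Energy density below `ε ≤ 1` gives `|u|² ≤ 2`, so `⟨iu, v⟩² < 2ε` and `P² < (4 + c²) ε`,
    -- against the choice of `ε`.
    obtain ⟨ε, hε⟩ : ∃ ε, ε = min 1 (P x ^ 2 / (4 + c ^ 2)) := ⟨_, rfl⟩
    have hε0 : 0 < ε := by rw [hε]; positivity
    obtain ⟨y, hy, hlt⟩ := exists_pos_lt_of_integrableOn_Ioi hint hε0
    rw [eq_of_hasDerivAt_zero_Ioi hPd hx hy] at hε
    have hε1 : ε ≤ 1 := hε ▸ min_le_left _ _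
    have hε2 : ε * (4 + c ^ 2) ≤ P y ^ 2 := by
      rw [← le_div_iff₀ (by positivity), hε]
      exact min_le_right _ _
    have h1 := normSq_mul_normSq_eq (u y) (v y)
    rw [hP] at hε2
    simp only at hε2
    generalize inner ℝ (Complex.I * u y) (v y) = p at *
    generalize inner ℝ (u y) (v y) = s at *
    have hu : ‖u y‖ ^ 2 ≤ 2 := by nlinarith [sq_nonneg ‖v y‖, sq_nonneg (1 - ‖u y‖ ^ 2)]
    have hv : ‖v y‖ ^ 2 < ε := by nlinarith [sq_nonneg (1 - ‖u y‖ ^ 2)]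
    have hw : (1 - ‖u y‖ ^ 2) ^ 2 < ε := by nlinarith [sq_nonneg ‖v y‖]
    have hp : p ^ 2 < 2 * ε := by nlinarith [sq_nonneg s, sq_nonneg ‖v y‖]
    have h2 : (p - c / 2 * (1 - ‖u y‖ ^ 2)) ^ 2
        ≤ 2 * p ^ 2 + c ^ 2 / 2 * (1 - ‖u y‖ ^ 2) ^ 2 := by
      nlinarith [sq_nonneg (p + c / 2 * (1 - ‖u y‖ ^ 2))]
    nlinarith [sq_nonneg c, mul_nonneg (sq_nonneg c) (sub_nonneg.2 hw.le)]
  rw [hP] at hz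
  simp only at hz
  linarith

/-- Energy first integral, from pairing the equation with `2v`; `⟨iv, v⟩ = 0` removes the term in
`c`. -/
theorem norm_sq_deriv_eq_of_ode {c κ : ℝ} (hκ : 0 < κ) {u v v' : ℝ → ℂ}
    (hd : ∀ x, 0 < x → HasDerivAt u (v x) x) (hd2 : ∀ x, 0 < x → HasDerivAt v (v' x) x)
    (heq : ∀ x, 0 < x → v' x - ((2 * κ * (‖v x‖ ^ 2 + inner ℝ (u x) (v' x)) : ℝ) : ℂ) * u x
      = -(Complex.I * c * v x + u x * ((1 - ‖u x‖ ^ 2 : ℝ) : ℂ)))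
    (hint : IntegrableOn (fun x => (1 - ‖u x‖ ^ 2) ^ 2 + ‖v x‖ ^ 2) (Set.Ioi 0)) {x : ℝ}
    (hx : 0 < x) :
    ‖v x‖ ^ 2 = (1 - ‖u x‖ ^ 2) ^ 2 / 2 + 2 * κ * inner ℝ (u x) (v x) ^ 2 := by
  obtain ⟨H, hH⟩ : ∃ H : ℝ → ℝ, H = fun x => ‖v x‖ ^ 2 - (1 - ‖u x‖ ^ 2) ^ 2 / 2
      - 2 * κ * inner ℝ (u x) (v x) ^ 2 := ⟨_, rfl⟩
  have hHd : ∀ x, 0 < x → HasDerivAt H 0 x := by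
    intro x hx
    have h1 := ((hd2 x hx).norm_sq.sub ((((hd x hx).norm_sq.const_sub 1).fun_pow 2).div_const 2)).sub
      ((((hd x hx).inner ℝ (hd2 x hx)).fun_pow 2).const_mul (2 * κ))
    rw [hH]
    refine h1.congr_deriv ?_
    have e1 := congrArg Complex.re (heq x hx)
    have e2 := congrArg Complex.im (heq x hx)
    simp [-Complex.ofReal_mul, -Complex.ofReal_add, -Complex.ofReal_sub, -Complex.ofReal_pow]
      at e1 e2
    simp only [Complex.inner, Complex.sq_norm, Complex.normSq_apply] at e1 e2 ⊢
    simp at e1 e2 ⊢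
    linear_combination 2 * (v x).re * e1 + 2 * (v x).im * e2
  have hz : H x = 0 := by
    by_contra hne
    have hpos : 0 < |H x| := abs_pos.2 hne
    -- Where the energy density is below `ε ≤ 1` one has `⟨u, v⟩² < 2ε`, hence `|H| < (2 + 4κ) ε`.
    obtain ⟨ε, hε⟩ : ∃ ε, ε = min 1 (|H x| / (2 + 4 * κ)) := ⟨_, rfl⟩
    have hε0 : 0 < ε := by rw [hε]; positivity
    obtain ⟨y, hy, hlt⟩ := exists_pos_lt_of_integrableOn_Ioi hint hε0
    rw [eq_of_hasDerivAt_zero_Ioi hHd hx hy] at hε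
    have hε1 : ε ≤ 1 := hε ▸ min_le_left _ _
    have hε2 : ε * (2 + 4 * κ) ≤ |H y| := by
      rw [← le_div_iff₀ (by positivity), hε]
      exact min_le_right _ _
    have h1 := normSq_mul_normSq_eq (u y) (v y)
    rw [hH] at hε2
    simp only at hε2
    generalize inner ℝ (Complex.I * u y) (v y) = p at *
    generalize inner ℝ (u y) (v y) = s at *
    have hu : ‖u y‖ ^ 2 ≤ 2 := by nlinarith [sq_nonneg ‖v y‖, sq_nonneg (1 - ‖u y‖ ^ 2)]
    have hv : ‖v y‖ ^ 2 < ε := by nlinarith [sq_nonneg (1 - ‖u y‖ ^ 2)]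
    have hw : (1 - ‖u y‖ ^ 2) ^ 2 < ε := by nlinarith [sq_nonneg ‖v y‖]
    have hs : s ^ 2 < 2 * ε := by nlinarith [sq_nonneg p, sq_nonneg ‖v y‖]
    have hs' : κ * s ^ 2 < κ * (2 * ε) := mul_lt_mul_of_pos_left hs hκ
    have hκs : 0 ≤ κ * s ^ 2 := by positivity
    have h2 : |‖v y‖ ^ 2 - (1 - ‖u y‖ ^ 2) ^ 2 / 2 - 2 * κ * s ^ 2| < ε * (2 + 4 * κ) := by
      rw [abs_lt]
      constructor <;> nlinarith [sq_nonneg ‖v y‖, sq_nonneg (1 - ‖u y‖ ^ 2)]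
    linarith
  rw [hH] at hz
  simp only at hz
  linarith

/-- Inserting both first integrals into `|u|²|v|² = ⟨u, v⟩² + ⟨iu, v⟩²` leaves the profile equation
for `1 - |u|²`. Only `c²` enters, so reflected solutions are covered too. -/
theorem norm_sq_eq_of_ode {c κ A : ℝ} (hκ : 0 < κ) (hb : 1 - 2 * κ ≠ 0) (hA : 0 ≤ A)
    (hc : c ^ 2 = 2 - (1 - 2 * κ) * A) {u v v' : ℝ → ℂ} (hu : Continuous u)
    (hd : ∀ x, 0 < x → HasDerivAt u (v x) x) (hd2 : ∀ x, 0 < x → HasDerivAt v (v' x) x)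
    (heq : ∀ x, 0 < x → v' x - ((2 * κ * (‖v x‖ ^ 2 + inner ℝ (u x) (v' x)) : ℝ) : ℂ) * u x
      = -(Complex.I * c * v x + u x * ((1 - ‖u x‖ ^ 2 : ℝ) : ℂ)))
    (hint : IntegrableOn (fun x => (1 - ‖u x‖ ^ 2) ^ 2 + ‖v x‖ ^ 2) (Set.Ioi 0))
    (h0 : ‖u 0‖ ^ 2 = 1 / (2 * κ)) (hne : ∀ x, 0 < x → ‖u x‖ ^ 2 ≠ 1 / (2 * κ)) {x : ℝ}
    (hx : 0 < x) : 1 - ‖u x‖ ^ 2 = profileValue κ A (timeInv κ A x) := by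
  refine eq_profileValue_timeInv hκ hA (η := fun x => 1 - ‖u x‖ ^ 2)
    (e := fun x => -(2 * inner ℝ (u x) (v x))) (by fun_prop) (fun y hy => ?_)
    (fun y hy => (hd y hy).norm_sq.const_sub 1) (fun y hy => ?_) hb ?_ (fun y hy h => ?_)
    (fun ε hε => ?_) x hx
  · exact (((hd y hy).inner ℝ (hd2 y hy)).continuousAt.const_mul 2).neg.continuousWithinAt
  · have h1 := norm_sq_deriv_eq_of_ode hκ hd hd2 heq hint hy
    have h2 := inner_I_mul_eq_of_ode hd hd2 heq hint hy
    have h3 := normSq_mul_normSq_eq (u y) (v y)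
    rw [h1, h2] at h3
    generalize inner ℝ (u y) (v y) = s at *
    linear_combination (-4) * h3 + (1 - ‖u y‖ ^ 2) ^ 2 * (-1) * hc
  · rw [eq_div_iff (by positivity)] at h0
    linarith
  · apply hne y hy
    rw [eq_div_iff (by positivity)]
    linarith
  · obtain ⟨y, hy, hlt⟩ := exists_pos_lt_of_integrableOn_Ioi hint (pow_pos hε 2)
    refine ⟨y, hy, abs_lt_of_sq_lt_sq ?_ hε.le⟩
    nlinarith [sq_nonneg ‖v y‖]

/-! ### Regularity of weak solutions away from the singular set -/

theorem ae_eq_const_add_primitive_complex {f g : ℝ → ℂ} (hf : LocallyIntegrable f)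
    (hg : LocallyIntegrable g)
    (hre : ∀ φ : ℝ → ℝ, ContDiff ℝ ∞ φ → HasCompactSupport φ →
      ∫ x, deriv φ x * (f x).re = -∫ x, φ x * (g x).re)
    (him : ∀ φ : ℝ → ℝ, ContDiff ℝ ∞ φ → HasCompactSupport φ →
      ∫ x, deriv φ x * (f x).im = -∫ x, φ x * (g x).im) :
    ∃ C : ℂ, ∀ᵐ x, f x = C + ∫ t in (0 : ℝ)..x, g t := by
  have hre' : ∀ h : ℝ → ℂ, LocallyIntegrable h → LocallyIntegrable fun x => (h x).re :=
    fun h hh => hh.mono (Complex.continuous_re.comp_aestronglyMeasurable hh.aestronglyMeasurable)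
      (Filter.Eventually.of_forall fun x => Complex.abs_re_le_norm _)
  have him' : ∀ h : ℝ → ℂ, LocallyIntegrable h → LocallyIntegrable fun x => (h x).im :=
    fun h hh => hh.mono (Complex.continuous_im.comp_aestronglyMeasurable hh.aestronglyMeasurable)
      (Filter.Eventually.of_forall fun x => Complex.abs_im_le_norm _)
  have hint : ∀ a b, IntervalIntegrable g volume a b := fun a b =>
    intervalIntegrable_iff.2 ((hg.integrableOn_isCompact isCompact_uIcc).mono_set
      Set.uIoc_subset_uIcc)
  obtain ⟨C₁, h₁⟩ := ae_eq_const_add_primitive (hre' f hf) (hre' g hg) hre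
  obtain ⟨C₂, h₂⟩ := ae_eq_const_add_primitive (him' f hf) (him' g hg) him
  refine ⟨⟨C₁, C₂⟩, ?_⟩
  filter_upwards [h₁, h₂] with x hx₁ hx₂
  apply Complex.ext
  · rw [hx₁, Complex.add_re]
    congr 1
    exact Complex.reCLM.intervalIntegral_comp_comm (hint 0 x)
  · rw [hx₂, Complex.add_im]
    congr 1
    exact Complex.imCLM.intervalIntegral_comp_comm (hint 0 x)

theorem integrable_ofReal_mul {f : ℝ → ℂ} {φ : ℝ → ℝ} (hf : LocallyIntegrable f)
    (hφ : Continuous φ) (hs : HasCompactSupport φ) :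
    Integrable fun x => ((φ x : ℝ) : ℂ) * f x := by
  have := hf.integrable_smul_left_of_hasCompactSupport hφ hs
  simpa only [Complex.real_smul] using this

theorem IsWeakDeriv.eq_add_primitive {u v : ℝ → ℂ} (h : IsWeakDeriv u v) (hu : Continuous u)
    (x : ℝ) : u x = u 0 + ∫ t in (0 : ℝ)..x, v t := by
  obtain ⟨h1, h2, h3⟩ := h
  have key : ∀ φ : ℝ → ℝ, ContDiff ℝ ∞ φ → HasCompactSupport φ →
      ∀ L : ℂ →L[ℝ] ℝ, ∫ x, L (((deriv φ x : ℝ) : ℂ) * u x) = -∫ x, L (((φ x : ℝ) : ℂ) * v x) := by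
    intro φ hφ hs L
    have hdc : Continuous (deriv φ) := hφ.continuous_deriv (by exact_mod_cast le_top)
    rw [L.integral_comp_comm (integrable_ofReal_mul h1 hdc hs.deriv),
      L.integral_comp_comm (integrable_ofReal_mul h2 hφ.continuous hs), h3 φ hφ hs, map_neg]
  obtain ⟨C, hC⟩ := ae_eq_const_add_primitive_complex h1 h2
    (fun φ hφ hs => by simpa using key φ hφ hs Complex.reCLM)
    (fun φ hφ hs => by simpa using key φ hφ hs Complex.imCLM)
  have hint : ∀ a b, IntervalIntegrable v volume a b := fun a b =>
    intervalIntegrable_iff.2 ((h2.integrableOn_isCompact isCompact_uIcc).mono_set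
      Set.uIoc_subset_uIcc)
  have hall : ∀ x, u x = C + ∫ t in (0 : ℝ)..x, v t := fun x => congrFun
    (Continuous.ae_eq_iff_eq volume hu (continuous_const.add
      (intervalIntegral.continuous_primitive hint 0)) |>.1 hC) x
  have h0 := hall 0
  rw [intervalIntegral.integral_same, add_zero] at h0
  rw [h0]
  exact hall x

theorem IsWeakDeriv.ae_eq {u v w : ℝ → ℂ} (hv : IsWeakDeriv u v) (hw : IsWeakDeriv u w) :
    v =ᵐ[volume] w := by
  have h : ∀ᵐ x, v x - w x = 0 := by
    refine ae_eq_zero_of_integral_contDiff_smul_eq_zero (hv.2.1.sub hw.2.1) fun φ hφ hs => ?_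
    have e1 := integrable_ofReal_mul hv.2.1 hφ.continuous hs
    have e2 := integrable_ofReal_mul hw.2.1 hφ.continuous hs
    have h3 := (hv.2.2 φ hφ hs).symm.trans (hw.2.2 φ hφ hs)
    simp only [Complex.real_smul, mul_sub]
    rw [integral_sub e1 e2, neg_inj.1 h3, sub_self]
  filter_upwards [h] with x hx
  exact sub_eq_zero.1 hx

theorem hasDerivAt_primitive_of_ae_eq {f g : ℝ → ℂ} (hf : LocallyIntegrable f)
    (hfg : f =ᵐ[volume] g) {x : ℝ} (hx : ContinuousAt g x) :
    HasDerivAt (fun x => ∫ t in (0 : ℝ)..x, f t) (g x) x := by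
  have e : (fun x => ∫ t in (0 : ℝ)..x, f t) = fun x => ∫ t in (0 : ℝ)..x, g t := by
    funext y
    exact intervalIntegral.integral_congr_ae (hfg.mono fun t ht _ => ht)
  have hg : LocallyIntegrable g := hf.mono (hf.aestronglyMeasurable.congr hfg)
    (hfg.mono fun t ht => by rw [ht])
  rw [e]
  exact intervalIntegral.integral_hasDerivAt_right
    (intervalIntegrable_iff.2 ((hg.integrableOn_isCompact isCompact_uIcc).mono_set
      Set.uIoc_subset_uIcc)) hg.aestronglyMeasurable.stronglyMeasurableAtFilter hx

/-- Regrouped, the weak equation reads `∫ ⟨f, φ'⟩ = ∫ ⟨g, φ⟩` with `f` the flux, so `-g` is the weak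
derivative of `f`. Test functions with values in `ℝ` and in `iℝ` separate the components. -/
theorem exists_flux_of_isWeakSolution {c κ : ℝ} {u v : ℝ → ℂ} (hu : Continuous u)
    (hv : MemLp v 2) (H : ∀ φ : ℝ → ℂ, ContDiff ℝ ∞ φ → HasCompactSupport φ →
      ∫ x, (inner ℝ (Complex.I * (c : ℂ) * v x + u x * ((1 - ‖u x‖ ^ 2 : ℝ) : ℂ)) (φ x)
        - inner ℝ (v x) (deriv φ x)
        + 2 * κ * inner ℝ (u x) (v x) * (inner ℝ (v x) (φ x) + inner ℝ (u x) (deriv φ x))) = 0) :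
    ∃ C : ℂ, ∀ᵐ x, v x - ((2 * κ * inner ℝ (u x) (v x) : ℝ) : ℂ) * u x
      = C - ∫ t in (0 : ℝ)..x, (Complex.I * c * v t + u t * ((1 - ‖u t‖ ^ 2 : ℝ) : ℂ)
        + ((2 * κ * inner ℝ (u t) (v t) : ℝ) : ℂ) * v t) := by
  have hg := locallyIntegrable_forcing c κ hu hv
  set g : ℝ → ℂ := fun t => Complex.I * c * v t + u t * ((1 - ‖u t‖ ^ 2 : ℝ) : ℂ)
    + ((2 * κ * inner ℝ (u t) (v t) : ℝ) : ℂ) * v t with hgdef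
  have hvl : LocallyIntegrable v := hv.locallyIntegrable (by norm_num)
  have hf : LocallyIntegrable fun x => v x - ((2 * κ * inner ℝ (u x) (v x) : ℝ) : ℂ) * u x := by
    refine hvl.sub (locallyIntegrable_of_norm_le_mul (f := v)
      (k := fun x => |2 * κ| * ‖u x‖ * ‖u x‖) (by fun_prop) hvl
      (aestronglyMeasurable_inner_mul _ hu hv.1 _ hu.aestronglyMeasurable) fun x => ?_)
    rw [norm_mul, Complex.norm_real, norm_mul, Real.norm_eq_abs (2 * κ)]
    calc |2 * κ| * ‖inner ℝ (u x) (v x)‖ * ‖u x‖ ≤ |2 * κ| * (‖u x‖ * ‖v x‖) * ‖u x‖ := by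
          gcongr
          exact norm_inner_le_norm _ _
      _ = |2 * κ| * ‖u x‖ * ‖u x‖ * ‖v x‖ := by ring
  set f : ℝ → ℂ := fun x => v x - ((2 * κ * inner ℝ (u x) (v x) : ℝ) : ℂ) * u x with hfdef
  have key : ∀ φ : ℝ → ℂ, ContDiff ℝ ∞ φ → HasCompactSupport φ →
      ∫ x, inner ℝ (f x) (deriv φ x) = ∫ x, inner ℝ (g x) (φ x) := by
    intro φ hφ hs
    have hdc : Continuous (deriv φ) := hφ.continuous_deriv (by exact_mod_cast le_top)
    have e1 := integrable_inner_of_hasCompactSupport hf hdc hs.deriv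
    have e2 := integrable_inner_of_hasCompactSupport hg hφ.continuous hs
    have h := H φ hφ hs
    symm
    rw [← sub_eq_zero, ← integral_sub e2 e1, ← h]
    congr 1 with x
    simp only [hfdef, hgdef, inner_add_left, inner_sub_left, Complex.inner]
    simp
    ring
  have test : ∀ z : ℂ, ∀ φ : ℝ → ℝ, ContDiff ℝ ∞ φ → HasCompactSupport φ →
      ∫ x, deriv φ x * inner ℝ (f x) z = ∫ x, φ x * inner ℝ (g x) z := by
    intro z φ hφ hs
    have hd : deriv (fun x => φ x • z) = fun x => deriv φ x • z := by
      funext x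
      exact ((hφ.differentiable (by simp) x).hasDerivAt.smul_const z).deriv
    have h := key (fun x => φ x • z) (hφ.smul contDiff_const) hs.smul_right
    simpa only [hd, inner_smul_right] using h
  obtain ⟨C, hC⟩ := ae_eq_const_add_primitive_complex hf hg.neg
    (fun φ hφ hs => by
      have := test 1 φ hφ hs
      simp only [Complex.inner, one_mul, Complex.conj_re] at this
      rw [this, ← integral_neg]
      simp)
    (fun φ hφ hs => by
      have := test Complex.I φ hφ hs
      simp only [Complex.inner, Complex.I_mul_re, Complex.conj_im, neg_neg] at this
      rw [this, ← integral_neg]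
      simp)
  refine ⟨C, ?_⟩
  filter_upwards [hC] with x hx
  refine hx.trans ?_
  rw [sub_eq_add_neg, ← intervalIntegral.integral_neg]
  rfl

/-- Bootstrap off the origin: the flux `w` is continuous, and `⟨u, w⟩ = (1 - 2κ|u|²)⟨u, v⟩` can be
solved for `⟨u, v⟩`, which makes `v` continuous. Then `w` is differentiable, and so is `v`. -/
theorem exists_classical_derivatives {c κ : ℝ} {u : ℝ → ℂ} (hκ : 0 < κ) (hu : MemEnergySpace u)
    (hsol : IsWeakSolution c κ u) (hΓ : singularSet κ u = {0}) :
    ∃ v v' : ℝ → ℂ, (∀ x, x ≠ 0 → HasDerivAt u (v x) x) ∧ (∀ x, x ≠ 0 → HasDerivAt v (v' x) x) ∧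
      (∀ x, x ≠ 0 → v' x - ((2 * κ * (‖v x‖ ^ 2 + inner ℝ (u x) (v' x)) : ℝ) : ℂ) * u x
        = -(Complex.I * c * v x + u x * ((1 - ‖u x‖ ^ 2 : ℝ) : ℂ))) ∧
      Integrable fun x => (1 - ‖u x‖ ^ 2) ^ 2 + ‖v x‖ ^ 2 := by
  obtain ⟨huc, hη, v₁, hv₁, hL⟩ := hu
  obtain ⟨v₀, hv₀, H⟩ := hsol
  have hv₀L : MemLp v₀ 2 := (memLp_congr_ae (hv₀.ae_eq hv₁)).2 hL
  have hF := locallyIntegrable_forcing c κ huc hv₀L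
  obtain ⟨C, hC⟩ := exists_flux_of_isWeakSolution huc hv₀L H
  obtain ⟨w, hw⟩ : ∃ w : ℝ → ℂ, w = fun x => C - ∫ t in (0 : ℝ)..x, (Complex.I * c * v₀ t
      + u t * ((1 - ‖u t‖ ^ 2 : ℝ) : ℂ) + ((2 * κ * inner ℝ (u t) (v₀ t) : ℝ) : ℂ) * v₀ t) :=
    ⟨_, rfl⟩
  have hwc : Continuous w := by
    rw [hw]
    refine continuous_const.sub (intervalIntegral.continuous_primitive (fun a b => ?_) 0)
    exact intervalIntegrable_iff.2 ((hF.integrableOn_isCompact isCompact_uIcc).mono_set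
      Set.uIoc_subset_uIcc)
  have hne : ∀ x, x ≠ 0 → 1 - 2 * κ * ‖u x‖ ^ 2 ≠ 0 := by
    intro x hx h
    have : x ∈ singularSet κ u := by
      rw [singularSet, Set.mem_ofPred_eq, eq_div_iff (by positivity)]
      linarith
    rw [hΓ] at this
    exact hx this
  -- the continuous representative of the derivative
  obtain ⟨v, hv⟩ : ∃ v : ℝ → ℂ, v = fun x => w x
      + ((2 * κ * (inner ℝ (u x) (w x) / (1 - 2 * κ * ‖u x‖ ^ 2)) : ℝ) : ℂ) * u x := ⟨_, rfl⟩
  have hs : ∀ x, x ≠ 0 →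
      inner ℝ (u x) (v x) = inner ℝ (u x) (w x) / (1 - 2 * κ * ‖u x‖ ^ 2) := by
    intro x hx
    have h := hne x hx
    rw [hv]
    simp only
    rw [inner_add_right, ← Complex.real_smul, inner_smul_right, real_inner_self_eq_norm_sq]
    field_simp
    ring
  have hwv : ∀ x, x ≠ 0 → w x = v x - ((2 * κ * inner ℝ (u x) (v x) : ℝ) : ℂ) * u x := by
    intro x hx
    rw [hs x hx, hv]
    simp only
    ring
  have hae : v₀ =ᵐ[volume] v := by
    filter_upwards [hC, compl_mem_ae_iff.2 (measure_singleton (0 : ℝ))] with x hx hx0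
    have h := hne x hx0
    have hwx : w x = v₀ x - ((2 * κ * inner ℝ (u x) (v₀ x) : ℝ) : ℂ) * u x := by
      rw [hx, hw]
    have h2 : inner ℝ (u x) (w x) = inner ℝ (u x) (v₀ x) * (1 - 2 * κ * ‖u x‖ ^ 2) := by
      rw [hwx, inner_sub_right, ← Complex.real_smul, inner_smul_right, real_inner_self_eq_norm_sq]
      ring
    rw [hv]
    simp only
    rw [h2, mul_div_cancel_right₀ _ h, hwx]
    ring
  have hvc : ∀ x, x ≠ 0 → ContinuousAt v x := by
    intro x hx
    rw [hv]
    have h1 : ContinuousAt (fun x => inner ℝ (u x) (w x) / (1 - 2 * κ * ‖u x‖ ^ 2)) x :=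
      (huc.inner hwc).continuousAt.div (by fun_prop) (hne x hx)
    exact hwc.continuousAt.add ((Complex.continuous_ofReal.continuousAt.comp
      (h1.const_mul (2 * κ))).mul huc.continuousAt)
  have hud : ∀ x, x ≠ 0 → HasDerivAt u (v x) x := by
    intro x hx
    have h1 := (hasDerivAt_primitive_of_ae_eq hv₀.2.1 hae (hvc x hx)).const_add (u 0)
    exact (funext (hv₀.eq_add_primitive huc) : u = _) ▸ h1
  have hwd : ∀ x, x ≠ 0 → HasDerivAt w (-(Complex.I * c * v x + u x * ((1 - ‖u x‖ ^ 2 : ℝ) : ℂ)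
      + ((2 * κ * inner ℝ (u x) (v x) : ℝ) : ℂ) * v x)) x := by
    intro x hx
    rw [hw]
    refine (hasDerivAt_primitive_of_ae_eq (g := fun x => Complex.I * c * v x
      + u x * ((1 - ‖u x‖ ^ 2 : ℝ) : ℂ) + ((2 * κ * inner ℝ (u x) (v x) : ℝ) : ℂ) * v x) hF
      (hae.mono fun t ht => by simp only [ht]) ?_).const_sub C
    have h1 := hvc x hx
    have h2 := huc.continuousAt (x := x)
    have h3 : ContinuousAt (fun x => ((2 * κ * inner ℝ (u x) (v x) : ℝ) : ℂ)) x :=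
      Complex.continuous_ofReal.continuousAt.comp ((h2.inner h1).const_mul (2 * κ))
    have h4 : ContinuousAt (fun x => u x * ((1 - ‖u x‖ ^ 2 : ℝ) : ℂ)) x := by fun_prop
    exact ((h1.const_mul _).add h4).add (h3.mul h1)
  have hvd : ∀ x, x ≠ 0 → DifferentiableAt ℝ v x := by
    intro x hx
    rw [hv]
    have h1 := (hwd x hx).differentiableAt
    have h2 := (hud x hx).differentiableAt
    have h3 : DifferentiableAt ℝ
        (fun x => 2 * κ * (inner ℝ (u x) (w x) / (1 - 2 * κ * ‖u x‖ ^ 2))) x :=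
      ((h2.inner ℝ h1).fun_div ((((hud x hx).norm_sq.differentiableAt).const_mul _).const_sub 1)
        (hne x hx)).const_mul _
    have h4 : DifferentiableAt ℝ
        (fun x => ((2 * κ * (inner ℝ (u x) (w x) / (1 - 2 * κ * ‖u x‖ ^ 2)) : ℝ) : ℂ)) x :=
      h3.hasDerivAt.ofReal_comp.differentiableAt
    exact h1.add (h4.mul h2)
  refine ⟨v, deriv v, hud, fun x hx => (hvd x hx).hasDerivAt, fun x hx => ?_, ?_⟩
  · have h1 := (hvd x hx).hasDerivAt
    have h2 := hud x hx
    have h3 := h1.sub ((((h2.inner ℝ h1).const_mul (2 * κ)).ofReal_comp).mul h2)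
    have h4 : w =ᶠ[𝓝 x] v - (fun x => ((2 * κ * inner ℝ (u x) (v x) : ℝ) : ℂ)) * u := by
      filter_upwards [isOpen_ne.mem_nhds hx] with y hy
      exact hwv y hy
    have h5 := (h3.congr_of_eventuallyEq h4).unique (hwd x hx)
    rw [real_inner_self_eq_norm_sq] at h5
    rw [add_comm (inner ℝ (u x) (deriv v x))] at h5
    linear_combination h5
  · have hvL : MemLp v 2 := (memLp_congr_ae hae).1 hv₀L
    exact ((memLp_two_iff_integrable_sq hη.1).1 hη).add
      ((memLp_two_iff_integrable_sq_norm hvL.1).1 hvL)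

/-! ### Uniqueness up to a phase -/

theorem hasDerivAt_comp_neg {E : Type*} [NormedAddCommGroup E] [NormedSpace ℝ E] {f : ℝ → E}
    {f' : E} {x : ℝ} (h : HasDerivAt f f' (-x)) : HasDerivAt (fun y => f (-y)) (-f') x :=
  (h.scomp x (hasDerivAt_neg x)).congr_deriv (by simp)

theorem eq_apply_zero_of_hasDerivAt_zero {E : Type*} [NormedAddCommGroup E] [NormedSpace ℝ E]
    {f : ℝ → E} (hf : Continuous f) (hd : ∀ x, x ≠ 0 → HasDerivAt f 0 x) (x : ℝ) : f x = f 0 := by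
  have key : ∀ g : ℝ → E, Continuous g → (∀ x, x ≠ 0 → HasDerivAt g 0 x) →
      ∀ x, 0 < x → g x = g 0 := by
    intro g hg hgd x hx
    refine tendsto_nhds_unique (tendsto_const_nhds.congr' ?_)
      (hg.continuousWithinAt (s := Set.Ioi 0) (x := 0)).tendsto
    filter_upwards [self_mem_nhdsWithin] with y hy
    exact eq_of_hasDerivAt_zero_Ioi (fun z hz => hgd z hz.ne') hx hy
  rcases lt_trichotomy x 0 with h | h | h
  · have := key (fun y => f (-y)) (by fun_prop) (fun y hy => by
      simpa using hasDerivAt_comp_neg (hd (-y) (neg_ne_zero.2 hy))) (-x) (by linarith)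
    simpa using this
  · rw [h]
  · exact key f hf hd x h

theorem conj_mul_eq (u v : ℂ) : (starRingEnd ℂ) u * v
    = ((inner ℝ u v : ℝ) : ℂ) + Complex.I * ((inner ℝ (Complex.I * u) v : ℝ) : ℂ) := by
  apply Complex.ext <;> simp [Complex.inner] <;> ring

section

variable {c κ A : ℝ} (hκ : 0 < κ) (hb : 1 - 2 * κ ≠ 0) (hA : 0 ≤ A) (hc0 : 0 ≤ c)
  (hc : c ^ 2 = 2 - (1 - 2 * κ) * A)

include hκ hb hA hc0 hc

/-- The modulus and both `⟨u, v⟩` and `⟨iu, v⟩` are determined, hence so is `v / u`, which agrees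
with the logarithmic derivative of the cuspon. Continuity at `0` makes the phase constant the same
on both sides. -/
theorem exists_phase_of_isWeakSolution {u : ℝ → ℂ} (hu : MemEnergySpace u)
    (hsol : IsWeakSolution c κ u) (hΓ : singularSet κ u = {0}) :
    ∃ φ : ℝ, ∀ x, u x = Complex.exp (Complex.I * (φ : ℂ)) * cuspon c κ x := by
  obtain ⟨v, v', hd, hd2, heq, hint⟩ := exists_classical_derivatives hκ hu hsol hΓ
  have huc := hu.1
  have h0 : ‖u 0‖ ^ 2 = 1 / (2 * κ) := by
    have : (0 : ℝ) ∈ singularSet κ u := by rw [hΓ]; rfl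
    exact this
  have hne : ∀ x, x ≠ 0 → ‖u x‖ ^ 2 ≠ 1 / (2 * κ) := by
    intro x hx h
    have : x ∈ singularSet κ u := h
    rw [hΓ] at this
    exact hx this
  have hpos : ∀ x, 0 < x → 1 - ‖u x‖ ^ 2 = cuspProfile c κ x ∧
      inner ℝ (Complex.I * u x) (v x) = c / 2 * (1 - ‖u x‖ ^ 2) := by
    intro x hx
    rw [cuspProfile_eq hκ hb hA hc0 hc]
    have hd' : ∀ x, 0 < x → HasDerivAt u (v x) x := fun x hx => hd x hx.ne'
    have hd2' : ∀ x, 0 < x → HasDerivAt v (v' x) x := fun x hx => hd2 x hx.ne'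
    exact ⟨norm_sq_eq_of_ode hκ hb hA hc huc hd' hd2' (fun x hx => heq x hx.ne')
      hint.integrableOn h0 (fun x hx => hne x hx.ne') hx,
      inner_I_mul_eq_of_ode hd' hd2' (fun x hx => heq x hx.ne') hint.integrableOn hx⟩
  -- The reflection `x ↦ u (-x)` solves the equation with `-c` and has the same singular point.
  have hneg : ∀ x, 0 < x → 1 - ‖u (-x)‖ ^ 2 = cuspProfile c κ x ∧
      inner ℝ (Complex.I * u (-x)) (-v (-x)) = -c / 2 * (1 - ‖u (-x)‖ ^ 2) := by
    intro x hx
    rw [cuspProfile_eq hκ hb hA hc0 hc]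
    have hd' : ∀ x, 0 < x → HasDerivAt (fun x => u (-x)) (-v (-x)) x := fun x hx =>
      hasDerivAt_comp_neg (hd (-x) (neg_ne_zero.2 hx.ne'))
    have hd2' : ∀ x, 0 < x → HasDerivAt (fun x => -v (-x)) (v' (-x)) x := fun x hx =>
      (hasDerivAt_comp_neg (hd2 (-x) (neg_ne_zero.2 hx.ne'))).fun_neg.congr_deriv (neg_neg _)
    have heq' : ∀ x, 0 < x → v' (-x)
        - ((2 * κ * (‖-v (-x)‖ ^ 2 + inner ℝ (u (-x)) (v' (-x))) : ℝ) : ℂ) * u (-x)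
        = -(Complex.I * ((-c : ℝ) : ℂ) * -v (-x) + u (-x) * ((1 - ‖u (-x)‖ ^ 2 : ℝ) : ℂ)) := by
      intro x hx
      rw [norm_neg, heq (-x) (neg_ne_zero.2 hx.ne')]
      push_cast
      ring
    have hint' : Integrable fun x => (1 - ‖u (-x)‖ ^ 2) ^ 2 + ‖-v (-x)‖ ^ 2 := by
      simpa only [norm_neg] using hint.comp_neg
    exact ⟨norm_sq_eq_of_ode (c := -c) hκ hb hA (by rw [neg_sq, hc]) (huc.comp continuous_neg)
      hd' hd2' heq' hint'.integrableOn (by simpa using h0)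
      (fun x hx => hne (-x) (neg_ne_zero.2 hx.ne')) hx,
      inner_I_mul_eq_of_ode hd' hd2' heq' hint'.integrableOn hx⟩
  have heven : ∀ x, cuspProfile c κ (-x) = cuspProfile c κ x := fun x => by
    simp [cuspProfile]
  have hη : ∀ x, x ≠ 0 → 1 - ‖u x‖ ^ 2 = cuspProfile c κ x := by
    intro x hx
    rcases lt_or_gt_of_ne hx with h | h
    · have := (hneg (-x) (by linarith)).1
      rwa [neg_neg, heven] at this
    · exact (hpos x h).1
  have hp : ∀ x, x ≠ 0 →
      inner ℝ (Complex.I * u x) (v x) = c / 2 * (1 - ‖u x‖ ^ 2) := by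
    intro x hx
    rcases lt_or_gt_of_ne hx with h | h
    · have := (hneg (-x) (by linarith)).2
      rw [neg_neg, inner_neg_right] at this
      linarith
    · exact (hpos x h).2
  have hs : ∀ x, x ≠ 0 → 2 * inner ℝ (u x) (v x) = cuspProfile c κ x / timeInv κ A x := by
    intro x hx
    have h1 := (hd x hx).norm_sq.const_sub 1
    have h2 : (fun x => 1 - ‖u x‖ ^ 2) =ᶠ[𝓝 x] cuspProfile c κ := by
      filter_upwards [isOpen_ne.mem_nhds hx] with y hy
      exact hη y hy
    have h3 := ((hasDerivAt_cuspProfile hκ hb hA hc0 hc hx).congr_of_eventuallyEq h2).unique h1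
    linarith
  have hvu : ∀ x, x ≠ 0 → v x = ((profileRatio κ A (timeInv κ A x) / (2 * timeInv κ A x) : ℝ)
      + Complex.I * (c * profileRatio κ A (timeInv κ A x) / 2 : ℝ)) * u x := by
    intro x hx
    have hη1 := one_sub_cuspProfile_pos hκ hb hA hc0 hc x
    have hnu : ‖u x‖ ^ 2 = 1 - cuspProfile c κ x := by linarith [hη x hx]
    have hu0 : (starRingEnd ℂ) (u x) ≠ 0 := by
      intro h
      rw [map_eq_zero] at h
      rw [h, norm_zero] at hnu
      norm_num at hnu
      linarith
    apply mul_left_cancel₀ hu0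
    rw [conj_mul_eq, hp x hx, hη x hx]
    have e1 : inner ℝ (u x) (v x)
        = profileRatio κ A (timeInv κ A x) / (2 * timeInv κ A x) * (1 - cuspProfile c κ x) := by
      have h1 := hs x hx
      have ht := timeInv_ne_zero hκ hA hx
      unfold profileRatio
      rw [← cuspProfile_eq hκ hb hA hc0 hc x]
      field_simp at h1 ⊢
      linarith
    have e2 : c / 2 * cuspProfile c κ x
        = c * profileRatio κ A (timeInv κ A x) / 2 * (1 - cuspProfile c κ x) := by
      unfold profileRatio
      rw [← cuspProfile_eq hκ hb hA hc0 hc x]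
      field_simp
    have e3 : (starRingEnd ℂ) (u x) * u x = ((1 - cuspProfile c κ x : ℝ) : ℂ) := by
      rw [← hnu, mul_comm, Complex.mul_conj, Complex.normSq_eq_norm_sq]
    rw [e1, e2, mul_comm (_ + _) (u x), ← mul_assoc, e3]
    push_cast
    ring
  have hU0 := cuspon_ne_zero hκ hb hA hc0 hc
  have hUc := continuous_cuspon hκ hb hA hc0 hc
  have hconst := eq_apply_zero_of_hasDerivAt_zero (f := fun x => u x / cuspon c κ x)
    (huc.div hUc hU0) (fun x hx => by
      refine ((hd x hx).fun_div (hasDerivAt_cuspon hκ hb hA hc0 hc hx) (hU0 x)).congr_deriv ?_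
      rw [hvu x hx]
      unfold cusponDeriv
      rw [div_eq_zero_iff]
      left
      ring)
  have hnorm : ‖u 0 / cuspon c κ 0‖ = 1 := by
    have h1 := norm_sq_cuspon hκ hb hA hc0 hc 0
    rw [cuspProfile_eq hκ hb hA hc0 hc, (one_sub_profileValue_eq_iff hκ hb hA _).2
      (timeInv_zero hκ hA), ← h0] at h1
    rw [norm_div, (sq_eq_sq₀ (norm_nonneg _) (norm_nonneg _)).1 h1,
      div_self (norm_ne_zero_iff.2 fun h => ?_)]
    rw [h, norm_zero] at h0
    have : (0 : ℝ) < 1 / (2 * κ) := by positivity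
    norm_num at h0
    linarith
  refine ⟨(u 0 / cuspon c κ 0).arg, fun x => ?_⟩
  have h1 := Complex.norm_mul_exp_arg_mul_I (u 0 / cuspon c κ 0)
  rw [hnorm, Complex.ofReal_one, one_mul, mul_comm _ Complex.I] at h1
  rw [h1, ← hconst x, div_mul_cancel₀ _ (hU0 x)]

/-- Since `η' = -η / t` with `η 0 ≠ 0` and `t → 0⁺`, the derivative tends to an infinite limit from
the right. -/
theorem not_differentiableAt_cuspProfile_zero : ¬ DifferentiableAt ℝ (cuspProfile c κ) 0 := by
  have hcont := continuous_cuspProfile hκ hb hA hc0 hc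
  have hη0 : cuspProfile c κ 0 ≠ 0 := by
    rw [cuspProfile_eq hκ hb hA hc0 hc, timeInv_zero hκ hA]
    exact div_ne_zero (mul_ne_zero hb (by norm_num)) (by positivity)
  have hτ : Filter.Tendsto (fun x => (timeInv κ A x)⁻¹) (𝓝[>] 0) Filter.atTop := by
    refine Filter.Tendsto.comp tendsto_inv_nhdsGT_zero (tendsto_nhdsWithin_iff.2 ⟨?_, ?_⟩)
    · have := (continuous_timeInv hκ hA).continuousWithinAt (s := Set.Ioi 0) (x := 0)
      rw [ContinuousWithinAt, timeInv_zero hκ hA] at this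
      exact this
    · filter_upwards [self_mem_nhdsWithin] with x hx
      exact timeInv_pos hκ hA hx
  have hlim : Filter.Tendsto (fun x => -cuspProfile c κ x) (𝓝[>] 0) (𝓝 (-cuspProfile c κ 0)) :=
    hcont.neg.continuousWithinAt.tendsto
  have hev : (fun x => -cuspProfile c κ x * (timeInv κ A x)⁻¹)
      =ᶠ[𝓝[>] 0] deriv (cuspProfile c κ) := by
    filter_upwards [self_mem_nhdsWithin] with x hx
    rw [(hasDerivAt_cuspProfile hκ hb hA hc0 hc (ne_of_gt hx)).deriv]
    ring
  intro h
  rcases lt_or_gt_of_ne hη0 with h1 | h1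
  · exact not_differentiableWithinAt_of_deriv_tendsto_atTop_Ioi _
      ((hlim.pos_mul_atTop (neg_pos.2 h1) hτ).congr' hev) h.differentiableWithinAt
  · exact not_differentiableWithinAt_of_deriv_tendsto_atBot_Ioi _
      ((hlim.neg_mul_atTop (neg_neg_of_pos h1) hτ).congr' hev) h.differentiableWithinAt

theorem nonDiffSet_const_mul_cuspon {K : ℂ} (hK : ‖K‖ = 1) :
    nonDiffSet (fun x => K * cuspon c κ x) = {0} := by
  ext x
  rw [nonDiffSet, Set.mem_ofPred_eq, Set.mem_singleton_iff]
  constructor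
  · intro h
    by_contra hx
    exact h ((hasDerivAt_cuspon hκ hb hA hc0 hc hx).const_mul K).differentiableAt
  · rintro rfl h
    apply not_differentiableAt_cuspProfile_zero hκ hb hA hc0 hc
    have e : cuspProfile c κ = fun x => 1 - ‖K * cuspon c κ x‖ ^ 2 := by
      funext x
      rw [norm_mul, hK, one_mul, norm_sq_cuspon hκ hb hA hc0 hc]
      ring
    rw [e]
    exact (h.norm_sq ℝ).const_sub 1

end

end

end Cuspon

theorem corollary1p4 (c κ : ℝ) (hcκ : (c, κ) ∈ Cuspon.regionDtilde) :
    Set.BijOn (Cuspon.cuspFun c κ) (Cuspon.profileRange κ) (Set.Ici 0) ∧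
    (Cuspon.MemEnergySpace (Cuspon.cuspon c κ) ∧
      Cuspon.IsWeakSolution c κ (Cuspon.cuspon c κ) ∧
      ¬ Cuspon.IsTrivial (Cuspon.cuspon c κ) ∧
      Cuspon.singularSet κ (Cuspon.cuspon c κ) = {0}) ∧
    ∀ u : ℝ → ℂ, Cuspon.MemEnergySpace u → Cuspon.IsWeakSolution c κ u →
      ¬ Cuspon.IsTrivial u → Cuspon.singularSet κ u = {0} →
        (∃ φ : ℝ, ∀ x, u x = Complex.exp (Complex.I * (φ : ℂ)) * Cuspon.cuspon c κ x) ∧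
        Cuspon.nonDiffSet u = {0} := by
  obtain ⟨hκ, hb, hc0, A, hA, hc⟩ := Cuspon.exists_ratio_of_mem_regionDtilde hcκ
  refine ⟨Cuspon.bijOn_cuspFun hκ hb hA hc0 hc,
    ⟨Cuspon.memEnergySpace_cuspon hκ hb hA hc0 hc, Cuspon.isWeakSolution_cuspon hκ hb hA hc0 hc,
      Cuspon.not_isTrivial_cuspon hκ hb hA hc0 hc, Cuspon.singularSet_cuspon hκ hb hA hc0 hc⟩,
    fun u hu hsol _ hΓ => ?_⟩
  obtain ⟨φ, hφ⟩ := Cuspon.exists_phase_of_isWeakSolution hκ hb hA hc0 hc hu hsol hΓ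
  refine ⟨⟨φ, hφ⟩, ?_⟩
  rw [funext hφ]
  refine Cuspon.nonDiffSet_const_mul_cuspon hκ hb hA hc0 hc ?_
  rw [mul_comm, Complex.norm_exp_ofReal_mul_I]
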